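/- Trees are finite ordered rooted trees; $|T|$ is the number of nodes of $T$, and $R(T)$ is the number of root subtrees of $T$, i.e. of non-empty sets of nodes that contain the parent of each of their non-root nodes. For a sequence $w=(w_i)_{i\ge 0}$ of nonnegative reals put $w(T)=\prod_{v\in T}w_{d(v)}$, where $d(v)$ is the number of children of $v$, let $\Phi(z)=\sum_i w_iz^i$, with radius of convergence $R\in[0,\infty]$, and let $\rho_m\in[0,\infty]$ be the radius of convergence of $F_m(z)=\sum_T w(T)R(T)^mz^{|T|}$, $m\ge 0$. (i) Let $\mathcal T_n$ be the conditioned Galton–Watson tree of size $n$, i.e. the Galton–Watson tree with offspring distribution $\xi$ conditioned on having size $n$, where $\mathbb E\,\xi=1$, $0<\operatorname{Var}\xi<\infty$ and $\mathbb E\,e^{t\xi}<\infty$ for some $t>0$. Let $w_i=\mathbb P(\xi=i)$, so that $\Phi(z)=\mathbb E\,z^{\xi}$, and assume that $\lim_{z\uparrow R}\Phi'(z)=\infty$. Then $0<\rho_m<\infty$ for all $m\ge 0$, and there are constants $\gamma_m>0$ $(m\ge1)$ and $1<\tau_1<\tau_2<\cdots$ such that, for each fixed $m\ge 1$, $$\mathbb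 E\,R(\mathcal T_n)^m=\bigl(1+O(1/n)\bigr)\gamma_m\tau_m^{\,n},$$ as $n\to\infty$ through the integers $n$ for which $\mathcal T_n$ exists, i.e. for which the Galton–Watson tree has size $n$ with positive probability. Moreover, $\tau_m=\rho_0/\rho_m$. (ii) Let $w$ be a sequence of nonnegative reals with $w_0>0$, and let $\mathcal T_n$ be the simply generated tree of size $n$, i.e. $\mathbb P(\mathcal T_n=T)=w(T)/\sum_{|T'|=n}w(T')$ for each $T$ with $|T|=n$; it exists if $\sum_{|T'|=n}w(T')>0$. Assume that $R>0$, that $\lim_{z\uparrow R}z\Phi'(z)/\Phi(z)>1$ (the limit may be $+\infty$), and that $\lim_{z\uparrow R}\Phi'(z)=\infty$. Then the conclusions of (i) hold for this $\mathcal T_n$, as $n\to\infty$ through the integers $n$ for which $\mathcal T_n$ exists, and these $\rho_m$. -/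

import Mathlib

open Filter Topology MeasureTheory ProbabilityTheory Asymptotics
open scoped ENNReal

noncomputable section

namespace RootSubtrees

/-! ### Finite ordered rooted trees

Nodes are addresses in the Ulam-Harris tree: the root is `[]`, and `v ++ [i]` is the child
number `i` (counted from `0`) of the node `v`. -/

/-- A finite ordered (plane) rooted tree: a finite set of addresses that contains the root,
the parent of each of its nodes, and all elder siblings of each of its nodes. -/
structure OrderedTree where
  nodes : Finset (List ℕ)
  root_mem : [] ∈ nodes
  parent_mem : ∀ v i, v ++ [i] ∈ nodes → v ∈ nodes
  sibling_mem : ∀ v i j, i < j → v ++ [j] ∈ nodes → v ++ [i] ∈ nodes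

/-- The size `|T|`: the number of nodes. -/
def OrderedTree.size (T : OrderedTree) : ℕ := T.nodes.card

/-- The out-degree of a node: its number of children. -/
def OrderedTree.outDegree (T : OrderedTree) (v : List ℕ) : ℕ :=
  {i : ℕ | v ++ [i] ∈ T.nodes}.ncard

/-- The weight `w(T) = ∏_{v ∈ T} w_{d(v)}`. -/
def OrderedTree.weight (w : ℕ → ℝ) (T : OrderedTree) : ℝ :=
  ∏ v ∈ T.nodes, w (T.outDegree v)

/-- The root subtrees of a tree with node set `T`: the non-empty sets of nodes that contain the
parent of each of their nodes other than the root. -/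
def rootSubtrees (T : Set (List ℕ)) : Set (Set (List ℕ)) :=
  {V | V ⊆ T ∧ V.Nonempty ∧ ∀ v i, v ++ [i] ∈ V → v ∈ V}

/-- `R(T)`, the number of root subtrees. -/
def numRootSubtrees (T : Set (List ℕ)) : ℕ := (rootSubtrees T).ncard

/-- The ordered trees of size `n`. -/
abbrev TreeOfSize (n : ℕ) : Type := {T : OrderedTree // T.size = n}

theorem OrderedTree.prefix_mem (T : OrderedTree) (v u : List ℕ) (h : v ++ u ∈ T.nodes) :
    v ∈ T.nodes := by
  induction u using List.reverseRecOn with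
  | nil => simpa using h
  | append_singleton u i ih => exact ih (T.parent_mem _ i (by simpa using h))

/-- There are finitely many ordered trees of each size, so that the sums over them below
are finite sums. -/
instance (n : ℕ) : Finite (TreeOfSize n) := by
  classical
  have hfin : {l : List ℕ | l.length < n ∧ ∀ x ∈ l, x < n}.Finite := by
    refine ((List.finite_length_lt (Fin n) n).image (List.map Fin.val)).subset ?_
    rintro l ⟨hl, hx⟩
    exact ⟨l.pmap (fun a h => (⟨a, h⟩ : Fin n)) hx, by simpa using hl,
      by simp [List.map_pmap]⟩
  have key : ∀ T : TreeOfSize n, T.1.nodes ∈ hfin.toFinset.powerset := by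
    intro T
    rw [Finset.mem_powerset]
    intro l hl
    have hT : T.1.nodes.card = n := T.2
    simp only [Set.Finite.mem_toFinset, Set.mem_ofPred_eq]
    constructor
    · have hsub : (Finset.range (l.length + 1)).image (fun k => l.take k) ⊆ T.1.nodes := by
        intro u hu
        obtain ⟨k, -, rfl⟩ := Finset.mem_image.1 hu
        exact T.1.prefix_mem (l.take k) (l.drop k) (by simpa using hl)
      have hc := Finset.card_le_card hsub
      rw [Finset.card_image_of_injOn, Finset.card_range, hT] at hc
      · omega
      · intro a ha b hb hab
        have := congrArg List.length hab
        simp at this ha hb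
        omega
    · intro x hx
      obtain ⟨a, b, rfl⟩ := List.append_of_mem hx
      have hm : a ++ [x] ∈ T.1.nodes := T.1.prefix_mem (a ++ [x]) b (by simpa using hl)
      have hsub : insert ([] : List ℕ) ((Finset.range (x + 1)).image (fun k => a ++ [k]))
          ⊆ T.1.nodes := by
        intro u hu
        rcases Finset.mem_insert.1 hu with rfl | hu
        · exact T.1.root_mem
        obtain ⟨k, hk, rfl⟩ := Finset.mem_image.1 hu
        rcases Nat.lt_succ_iff_lt_or_eq.1 (Finset.mem_range.1 hk) with h | rfl
        · exact T.1.sibling_mem a k x h hm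
        · exact hm
      have hc := Finset.card_le_card hsub
      rw [Finset.card_insert_of_notMem (by simp), Finset.card_image_of_injective,
        Finset.card_range, hT] at hc
      · omega
      · intro p q hpq
        simpa using hpq
  refine Finite.of_injective (fun T : TreeOfSize n =>
    (⟨T.1.nodes, key T⟩ : {s // s ∈ hfin.toFinset.powerset})) ?_
  rintro ⟨⟨s, _, _, _⟩, _⟩ ⟨⟨t, _, _, _⟩, _⟩ h
  simpa using h

/-! ### Generating functions -/

/-- The radius of convergence, in `[0, ∞]`, of the power series `∑ a_n z^n`. -/
def radius (a : ℕ → ℝ) : ℝ≥0∞ := (FormalMultilinearSeries.ofScalars ℝ a).radius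

/-- The generator `Φ(z) = ∑ w_i z^i`. -/
def generator (w : ℕ → ℝ) (z : ℝ) : ℝ := ∑' i, w i * z ^ i

/-- The filter `z ↑ R`, for `0 < R ≤ ∞`. -/
def upTo (R : ℝ≥0∞) : Filter ℝ := if R = ⊤ then atTop else 𝓝[<] R.toReal

/-- The coefficient `∑_{|T| = n} w(T) R(T)^m` of `z^n` in `F_m(z) = ∑_T w(T) R(T)^m z^{|T|}`. -/
def coeffF (w : ℕ → ℝ) (m n : ℕ) : ℝ :=
  ∑' T : TreeOfSize n, T.1.weight w * (numRootSubtrees T.1.nodes : ℝ) ^ m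

/-- The radius of convergence `ρ_m` of `F_m`. -/
def rho (w : ℕ → ℝ) (m : ℕ) : ℝ≥0∞ := radius (coeffF w m)

/-! ### Simply generated trees -/

/-- The total weight of the ordered trees of size `n`. The simply generated tree of size `n`
exists if and only if this is positive. -/
def totalWeight (w : ℕ → ℝ) (n : ℕ) : ℝ := ∑' T : TreeOfSize n, T.1.weight w

/-- `P(T_n = T) = w(T) / ∑_{|T'| = n} w(T')`, for a tree `T` of size `n`. -/
def simplyGeneratedProb (w : ℕ → ℝ) (n : ℕ) (T : TreeOfSize n) : ℝ :=
  T.1.weight w / totalWeight w n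

/-- `E R(T_n)^m` for the simply generated tree `T_n` with weight sequence `w`. -/
def simplyGeneratedMoment (w : ℕ → ℝ) (m n : ℕ) : ℝ :=
  ∑' T : TreeOfSize n, simplyGeneratedProb w n T * (numRootSubtrees T.1.nodes : ℝ) ^ m

/-! ### Conditioned Galton-Watson trees -/

/-- The (possibly infinite) tree in which each node `v` has `x v` children: an address belongs
to it if each step `i` on the way from the root to it, taken at a node `v`, satisfies
`i < x v`. If the `x v` are independent copies of `ξ`, this is the Galton-Watson tree. -/
def treeOfDegrees (x : List ℕ → ℕ) : Set (List ℕ) :=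
  {u | ∀ v i, v ++ [i] <+: u → i < x v}

variable {Ω : Type*} [MeasurableSpace Ω]

/-- The event that the Galton-Watson tree has size `n`. -/
def sizeEvent (ξ : List ℕ → Ω → ℕ) (n : ℕ) : Set Ω :=
  {ω | (treeOfDegrees fun v => ξ v ω).encard = n}

/-- `E R(T_n)^m` for the conditioned Galton-Watson tree `T_n`, that is, for the Galton-Watson
tree conditioned on having size `n`. -/
def conditionedGWMoment (μ : Measure Ω) (ξ : List ℕ → Ω → ℕ) (m n : ℕ) : ℝ :=
  ∫ ω, (numRootSubtrees (treeOfDegrees fun v => ξ v ω) : ℝ) ^ m ∂(μ[|sizeEvent ξ n])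

/-! ### The asymptotic statement -/

/-- There are `γ_m > 0` and `1 < τ_1 < τ_2 < ⋯` such that, for each fixed `m ≥ 1`,
`E_{m,n} = (1 + O(1/n)) γ_m τ_m^n`, where `n` runs through `N`; moreover the `ρ_m` are positive
and finite and `τ_m = ρ_0 / ρ_m`. -/
def MomentAsymptotics (E : ℕ → ℕ → ℝ) (N : Set ℕ) (ρ : ℕ → ℝ≥0∞) : Prop :=
  ∃ γ τ : ℕ → ℝ,
    (∀ m, 1 ≤ m → 0 < γ m) ∧
    1 < τ 1 ∧
    (∀ m, 1 ≤ m → τ m < τ (m + 1)) ∧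
    (∀ m, 0 < ρ m ∧ ρ m < ⊤) ∧
    (∀ m, 1 ≤ m → τ m = (ρ 0).toReal / (ρ m).toReal) ∧
    ∀ m, 1 ≤ m → ∃ ε : ℕ → ℝ,
      ε =O[atTop] (fun n : ℕ => (1 : ℝ) / n) ∧
      ∀ n ∈ N, E m n = (1 + ε n) * γ m * τ m ^ n

end RootSubtrees

end

noncomputable section

namespace RootSubtrees

/-! ### Transfer at a square-root singularity -/

/-- The principal branch of `√(1 - u)`. -/
def sqrtOneSub (u : ℂ) : ℂ := (1 - u) ^ (1 / 2 : ℂ)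

theorem sqrtOneSub_sq (u : ℂ) : sqrtOneSub u ^ 2 = 1 - u := by
  simp [sqrtOneSub, one_div]

theorem sqrtOneSub_pow (u : ℂ) (k : ℕ) : sqrtOneSub u ^ k = (1 - u) ^ ((k / 2 : ℝ) : ℂ) := by
  rw [sqrtOneSub, ← Complex.cpow_nat_mul]
  congr 1
  push_cast
  ring

theorem sqrtOneSub_ne_zero {u : ℂ} (hu : u ≠ 1) : sqrtOneSub u ≠ 0 := by
  intro h
  have := sqrtOneSub_sq u
  rw [h] at this
  exact hu (by linear_combination this)

theorem one_sub_mem_slitPlane {u : ℂ} (hu : ‖u‖ ≤ 1) (h1 : u ≠ 1) : 1 - u ∈ Complex.slitPlane := by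
  rw [Complex.mem_slitPlane_iff]
  by_contra! h
  obtain ⟨h2, h3⟩ := h
  simp only [Complex.sub_re, Complex.one_re, Complex.sub_im, Complex.one_im] at h2 h3
  have h4 := (Complex.abs_re_le_norm u).trans hu
  have h5 : u.re = 1 := le_antisymm ((le_abs_self _).trans h4) (by linarith)
  exact h1 (Complex.ext (by simp [h5]) (by simpa using h3))

theorem analyticAt_sqrtOneSub {u : ℂ} (hu : 1 - u ∈ Complex.slitPlane) :
    AnalyticAt ℂ sqrtOneSub u := by
  unfold sqrtOneSub
  exact (analyticAt_const.sub analyticAt_id).cpow analyticAt_const hu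

theorem hasDerivAt_sqrtOneSub {u : ℂ} (hu : 1 - u ∈ Complex.slitPlane) :
    HasDerivAt sqrtOneSub (-1 / (2 * sqrtOneSub u)) u := by
  have h0 : u ≠ 1 := by rintro rfl; simp at hu
  have h1 := (analyticAt_sqrtOneSub hu).differentiableAt.hasDerivAt
  have h2 := h1.pow 2
  have h3 : HasDerivAt (fun v => sqrtOneSub v ^ 2) (-1) u := by
    simp_rw [sqrtOneSub_sq]
    simpa using (hasDerivAt_id u).const_sub 1
  have h4 := h2.unique h3
  have h5 := sqrtOneSub_ne_zero h0
  have h6 : -1 / (2 * sqrtOneSub u) = deriv sqrtOneSub u := by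
    rw [div_eq_iff (mul_ne_zero two_ne_zero h5)]
    simp only [Nat.cast_ofNat, Nat.add_one_sub_one, pow_one] at h4
    linear_combination -h4
  rwa [h6]

theorem tendsto_sqrtOneSub : Tendsto sqrtOneSub (𝓝 1) (𝓝 0) := by
  have h : Tendsto (fun u => ‖sqrtOneSub u‖ ^ 2) (𝓝 1) (𝓝 0) := by
    have : (fun u => ‖sqrtOneSub u‖ ^ 2) = fun u => ‖1 - u‖ := by
      ext u
      rw [← norm_pow, sqrtOneSub_sq]
    rw [this]
    have : Continuous fun u : ℂ => ‖1 - u‖ := by fun_prop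
    simpa using this.tendsto 1
  rw [tendsto_zero_iff_norm_tendsto_zero]
  have h2 := (Real.continuous_sqrt.tendsto 0).comp h
  simpa [Function.comp_def, Real.sqrt_sq] using h2

/-- The coefficient of `u ^ n` in `√(1 - u) ^ k`. -/
def sqrtCoeff (k n : ℕ) : ℝ := (-1) ^ n * Ring.choose (k / 2 : ℝ) n

theorem iteratedDeriv_eq_of_hasFPowerSeriesAt {f : ℂ → ℂ} {c : ℕ → ℂ}
    (h : HasFPowerSeriesAt f (.ofScalars ℂ c) 0) (n : ℕ) :
    iteratedDeriv n f 0 / n.factorial = c n := by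
  have h1 := h.analyticAt.hasFPowerSeriesAt
  have h2 := h1.eq_formalMultilinearSeries h
  exact congrFun (FormalMultilinearSeries.ofScalars_series_injective ℂ ℂ h2) n

theorem iteratedDeriv_sqrtOneSub_pow (k n : ℕ) :
    iteratedDeriv n (fun u => sqrtOneSub u ^ k) 0 / n.factorial = sqrtCoeff k n := by
  have h : HasFPowerSeriesAt (fun u : ℂ => (1 + u) ^ ((k / 2 : ℝ) : ℂ))
      (binomialSeries ℂ ((k / 2 : ℝ) : ℂ)) ((-1 : ℂ →L[ℂ] ℂ) 0) := by
    simpa using Complex.one_add_cpow_hasFPowerSeriesAt_zero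
  have h2 := h.compContinuousLinearMap (u := (-1 : ℂ →L[ℂ] ℂ))
  have h3 : (binomialSeries ℂ ((k / 2 : ℝ) : ℂ)).compContinuousLinearMap (-1 : ℂ →L[ℂ] ℂ) =
      .ofScalars ℂ fun n => (sqrtCoeff k n : ℂ) := by
    ext n
    simp [FormalMultilinearSeries.compContinuousLinearMap, binomialSeries, sqrtCoeff,
      Complex.ofReal_choose]
  rw [h3] at h2
  have h4 := iteratedDeriv_eq_of_hasFPowerSeriesAt h2 n
  rw [← h4]
  congr 2
  ext u
  rw [sqrtOneSub_pow]
  simp [sub_eq_add_neg]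

theorem choose_succ_mul (a : ℝ) (n : ℕ) :
    Ring.choose a (n + 1) * (n + 1) = Ring.choose a n * (a - n) := by
  rw [Ring.choose_eq_smul, Ring.choose_eq_smul, descPochhammer_succ_right, Polynomial.smeval_mul,
    Nat.factorial_succ]
  have : (n.factorial : ℝ) ≠ 0 := by positivity
  simp [Polynomial.smeval_natCast]
  field_simp

theorem choose_add_one_mul (a : ℝ) (n : ℕ) :
    Ring.choose (a + 1) n * (a + 1 - n) = Ring.choose a n * (a + 1) := by
  cases n with
  | zero => simp
  | succ n =>
    have h1 := choose_succ_mul a n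
    rw [Ring.choose_succ_succ]
    push_cast
    linear_combination -h1

theorem sqrtCoeff_add_two (k n : ℕ) :
    sqrtCoeff (k + 2) n * (k / 2 + 1 - n) = sqrtCoeff k n * (k / 2 + 1) := by
  have := choose_add_one_mul (k / 2 : ℝ) n
  have h2 : ((k + 2 : ℕ) : ℝ) / 2 = k / 2 + 1 := by push_cast; ring
  rw [sqrtCoeff, sqrtCoeff, h2]
  linear_combination (-1) ^ n * this

theorem sqrtCoeff_succ (k n : ℕ) :
    sqrtCoeff k (n + 1) * (n + 1) = sqrtCoeff k n * (n - k / 2) := by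
  have := choose_succ_mul (k / 2 : ℝ) n
  rw [sqrtCoeff, sqrtCoeff, pow_succ]
  linear_combination (-1) ^ (n + 1) * this

theorem sqrtCoeff_even {j n : ℕ} (h : j < n) : sqrtCoeff (2 * j) n = 0 := by
  have h2 : ((2 * j : ℕ) : ℝ) / 2 = (j : ℕ) := by push_cast; ring
  rw [sqrtCoeff, h2, Ring.choose_natCast, Nat.choose_eq_zero_of_lt h]
  simp

theorem sqrtCoeff_one_succ (n : ℕ) :
    -sqrtCoeff 1 (n + 1) * (n + 1) = -sqrtCoeff 1 n * (n - 1 / 2) := by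
  have := sqrtCoeff_succ 1 n
  push_cast at this
  linear_combination -this

theorem half_le_sq_mul_sqrtCoeff (n : ℕ) : 1 / 2 ≤ -sqrtCoeff 1 (n + 1) * (n + 1) ^ 2 := by
  induction n with
  | zero => simp [sqrtCoeff]
  | succ n ih =>
    have h1 := sqrtCoeff_one_succ (n + 1)
    have h2 : 0 ≤ -sqrtCoeff 1 (n + 1) := by
      by_contra! h
      nlinarith [mul_neg_of_neg_of_pos h (show (0 : ℝ) < (n + 1) ^ 2 by positivity)]
    push_cast at h1 ⊢
    have h3 : -sqrtCoeff 1 (n + 1 + 1) * ((n : ℝ) + 1 + 1) ^ 2 =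
        -sqrtCoeff 1 (n + 1) * ((n + 1 - 1 / 2) * (n + 1 + 1)) := by
      linear_combination (n + 1 + 1 : ℝ) * h1
    rw [h3]
    refine ih.trans (mul_le_mul_of_nonneg_left ?_ h2)
    nlinarith [(Nat.cast_nonneg n : (0 : ℝ) ≤ n)]

theorem inv_sq_le_sqrtCoeff {n : ℕ} (hn : 0 < n) : 1 / 2 / (n : ℝ) ^ 2 ≤ -sqrtCoeff 1 n := by
  obtain ⟨n, rfl⟩ := Nat.exists_eq_succ_of_ne_zero hn.ne'
  have := half_le_sq_mul_sqrtCoeff n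
  rw [div_le_iff₀ (by positivity)]
  simpa using this

theorem neg_sqrtCoeff_pos {n : ℕ} (hn : 0 < n) : 0 < -sqrtCoeff 1 n :=
  lt_of_lt_of_le (by positivity) (inv_sq_le_sqrtCoeff hn)

theorem sqrtCoeff_odd_isBigO (j : ℕ) :
    (fun n => sqrtCoeff (2 * j + 3) n) =O[atTop] fun n => -sqrtCoeff 1 n / (n : ℝ) := by
  have step : ∀ i, (fun n => sqrtCoeff (i + 2) n) =O[atTop] fun n => sqrtCoeff i n / (n : ℝ) := by
    intro i
    refine IsBigO.of_bound (i + 2) ?_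
    filter_upwards [eventually_ge_atTop (i + 3)] with n hn
    have h := sqrtCoeff_add_two i n
    have hn' : (i : ℝ) + 3 ≤ n := by exact_mod_cast hn
    have hi : (0 : ℝ) ≤ i := by positivity
    have hn0 : (0 : ℝ) < n := by linarith
    have h1 : |sqrtCoeff (i + 2) n| * (n - (i / 2 + 1)) = |sqrtCoeff i n| * (i / 2 + 1) := by
      rw [← abs_of_nonneg (show (0 : ℝ) ≤ i / 2 + 1 by positivity), ← abs_mul,
        abs_of_nonneg (show (0 : ℝ) ≤ i / 2 + 1 by positivity), ← h, abs_mul,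
        abs_sub_comm, abs_of_nonneg (show (0 : ℝ) ≤ n - (i / 2 + 1) by linarith)]
    rw [norm_div, Real.norm_eq_abs, Real.norm_eq_abs, Real.norm_of_nonneg hn0.le, ← mul_div_assoc,
      le_div_iff₀ hn0]
    have h2 : (n : ℝ) / 2 ≤ n - (i / 2 + 1) := by linarith
    nlinarith [mul_le_mul_of_nonneg_left h2 (abs_nonneg (sqrtCoeff (i + 2) n))]
  induction j with
  | zero => simpa [neg_div] using step 1
  | succ j ih =>
    refine (step (2 * j + 3)).trans ?_
    refine IsBigO.trans ?_ ih
    refine IsBigO.of_bound 1 ?_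
    filter_upwards [eventually_ge_atTop 1] with n hn
    have : (1 : ℝ) ≤ n := by exact_mod_cast hn
    rw [norm_div, one_mul, Real.norm_natCast]
    exact div_le_self (norm_nonneg _) this

open Metric in
theorem eventually_nhdsWithin_ball_mem_slitPlane (p : ℂ) :
    ∀ᶠ u in 𝓝[ball 0 1] p, 1 - u ∈ Complex.slitPlane := by
  filter_upwards [self_mem_nhdsWithin] with u hu
  have hu' : ‖u‖ < 1 := by simpa using hu
  exact one_sub_mem_slitPlane hu'.le (by rintro rfl; simp at hu')

open Metric in
theorem eventuallyEq_deriv_of_eventuallyEq_sqrtOneSub {g L : ℂ → ℂ} {k : ℕ}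
    (hL : AnalyticAt ℂ L 0)
    (h : g =ᶠ[𝓝[ball 0 1] 1] fun u => sqrtOneSub u ^ (k + 2) * L (sqrtOneSub u)) :
    ∃ L' : ℂ → ℂ, AnalyticAt ℂ L' 0 ∧
      deriv g =ᶠ[𝓝[ball 0 1] 1] fun u => sqrtOneSub u ^ k * L' (sqrtOneSub u) := by
  refine ⟨fun s => -(1 / 2) * ((k + 2) * L s + s * deriv L s), by fun_prop, ?_⟩
  have h1 := eventually_eventually_nhdsWithin.2 h
  have h2 : ∀ᶠ u in 𝓝[ball 0 1] (1 : ℂ), AnalyticAt ℂ L (sqrtOneSub u) :=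
    (tendsto_sqrtOneSub.mono_left nhdsWithin_le_nhds).eventually hL.eventually_analyticAt
  filter_upwards [h1, h2, eventually_nhdsWithin_ball_mem_slitPlane 1,
    self_mem_nhdsWithin] with u hu1 hu2 hu3 hu4
  rw [isOpen_ball.nhdsWithin_eq hu4] at hu1
  have hS := hasDerivAt_sqrtOneSub hu3
  have h0 : sqrtOneSub u ≠ 0 := sqrtOneSub_ne_zero (by rintro rfl; simp at hu4)
  have hd := (hS.pow (k + 2)).mul (hu2.differentiableAt.hasDerivAt.comp u hS)
  have hg : HasDerivAt g _ u := hd.congr_of_eventuallyEq hu1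
  rw [hg.deriv]
  simp only [Pi.pow_apply, Function.comp_apply]
  have e : k + 2 - 1 = k + 1 := rfl
  rw [e]
  push_cast
  field_simp
  ring

open Metric in
theorem exists_bound_iteratedDeriv {r : ℂ → ℂ} (hr : AnalyticOnNhd ℂ r (ball 0 1))
    (hbd : ∀ p : ℂ, ‖p‖ = 1 → p ≠ 1 → ∃ e : ℂ → ℂ, AnalyticAt ℂ e p ∧ r =ᶠ[𝓝[ball 0 1] p] e)
    {L : ℂ → ℂ} (hL : AnalyticAt ℂ L 0)
    (h1 : r =ᶠ[𝓝[ball 0 1] 1] fun u => sqrtOneSub u ^ 7 * L (sqrtOneSub u)) :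
    ∃ M, ∀ u ∈ ball (0 : ℂ) 1, ‖iteratedDeriv 3 r u‖ ≤ M := by
  have key : ∀ p ∈ closedBall (0 : ℂ) 1, ∃ c : ℂ,
      Tendsto (iteratedDeriv 3 r) (𝓝[ball 0 1] p) (𝓝 c) := by
    intro p hp
    have hp' : ‖p‖ ≤ 1 := by simpa using hp
    rcases hp'.lt_or_eq with h | h
    · have : AnalyticAt ℂ (iteratedDeriv 3 r) p := by
        rw [iteratedDeriv_eq_iterate]
        exact (hr p (by simpa using h)).iterated_deriv 3
      exact ⟨_, this.continuousAt.tendsto.mono_left nhdsWithin_le_nhds⟩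
    · by_cases hp1 : p = 1
      · subst hp1
        obtain ⟨L1, hL1, hd1⟩ := eventuallyEq_deriv_of_eventuallyEq_sqrtOneSub (k := 5) hL h1
        obtain ⟨L2, hL2, hd2⟩ := eventuallyEq_deriv_of_eventuallyEq_sqrtOneSub (k := 3) hL1 hd1
        obtain ⟨L3, hL3, hd3⟩ := eventuallyEq_deriv_of_eventuallyEq_sqrtOneSub (k := 1) hL2 hd2
        have hs := tendsto_sqrtOneSub.mono_left (nhdsWithin_le_nhds (s := ball 0 1))
        refine ⟨0 ^ 1 * L3 0, ?_⟩
        have e : iteratedDeriv 3 r = deriv (deriv (deriv r)) := by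
          simp [iteratedDeriv_eq_iterate]
        rw [e]
        exact ((hs.pow 1).mul (hL3.continuousAt.tendsto.comp hs)).congr' hd3.symm
      · obtain ⟨e, he, hre⟩ := hbd p h hp1
        have he3 : AnalyticAt ℂ (iteratedDeriv 3 e) p := by
          rw [iteratedDeriv_eq_iterate]
          exact he.iterated_deriv 3
        refine ⟨_, (he3.continuousAt.tendsto.mono_left nhdsWithin_le_nhds).congr' ?_⟩
        filter_upwards [eventually_eventually_nhdsWithin.2 hre, self_mem_nhdsWithin] with u h2 h3
        rw [isOpen_ball.nhdsWithin_eq h3] at h2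
        exact (EventuallyEq.iteratedDeriv_eq 3 h2).symm
  have main : ∃ M, ∀ u ∈ closedBall (0 : ℂ) 1, u ∈ ball (0 : ℂ) 1 →
      ‖iteratedDeriv 3 r u‖ ≤ M := by
    refine (isCompact_closedBall (0 : ℂ) 1).induction_on
      (p := fun s => ∃ M, ∀ u ∈ s, u ∈ ball (0 : ℂ) 1 → ‖iteratedDeriv 3 r u‖ ≤ M) ?_ ?_ ?_ ?_
    · exact ⟨0, by simp⟩
    · rintro s t hst ⟨M, hM⟩
      exact ⟨M, fun u hu => hM u (hst hu)⟩
    · rintro s t ⟨M, hM⟩ ⟨N, hN⟩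
      refine ⟨max M N, ?_⟩
      rintro u (hu | hu) hb
      · exact (hM u hu hb).trans (le_max_left _ _)
      · exact (hN u hu hb).trans (le_max_right _ _)
    · intro p hp
      obtain ⟨c, hc⟩ := key p hp
      have h2 : ∀ᶠ u in 𝓝[ball 0 1] p, ‖iteratedDeriv 3 r u‖ ≤ ‖c‖ + 1 :=
        hc.norm.eventually_le_const (by linarith)
      refine ⟨{u | u ∈ ball (0 : ℂ) 1 → ‖iteratedDeriv 3 r u‖ ≤ ‖c‖ + 1}, ?_, ‖c‖ + 1,
        fun u hu => hu⟩
      exact mem_nhdsWithin_of_mem_nhds (eventually_nhdsWithin_iff.1 h2)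
  obtain ⟨M, hM⟩ := main
  exact ⟨M, fun u hu => hM u (ball_subset_closedBall hu) hu⟩

open Metric in
theorem coeff_isBigO_of_bound_iteratedDeriv {r : ℂ → ℂ} (hr : AnalyticOnNhd ℂ r (ball 0 1))
    {M : ℝ} (hM : ∀ u ∈ ball (0 : ℂ) 1, ‖iteratedDeriv 3 r u‖ ≤ M) :
    (fun n => iteratedDeriv n r 0 / n.factorial) =O[atTop] fun n : ℕ => ((n : ℝ) ^ 3)⁻¹ := by
  have hb : ∀ n, ‖iteratedDeriv (n + 3) r 0‖ ≤ n.factorial * M := by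
    intro n
    have e : iteratedDeriv (n + 3) r = iteratedDeriv n (iteratedDeriv 3 r) := by
      simp [iteratedDeriv_eq_iterate, Function.iterate_add_apply]
    rw [e]
    have ht : Tendsto (fun R : ℝ => n.factorial * M / R ^ n) (𝓝[<] 1)
        (𝓝 (n.factorial * M / 1 ^ n)) := by
      refine Tendsto.mono_left ?_ nhdsWithin_le_nhds
      exact (tendsto_const_nhds).div (tendsto_id.pow n) (by simp)
    rw [one_pow, div_one] at ht
    refine ge_of_tendsto ht ?_
    filter_upwards [Ioo_mem_nhdsLT (show (0 : ℝ) < 1 by norm_num)] with R hR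
    have hsub : closedBall (0 : ℂ) R ⊆ ball 0 1 := closedBall_subset_ball hR.2
    have han : AnalyticOnNhd ℂ (iteratedDeriv 3 r) (ball 0 1) := by
      rw [iteratedDeriv_eq_iterate]
      exact hr.iterated_deriv 3
    refine Complex.norm_iteratedDeriv_le_of_forall_mem_sphere_norm_le n hR.1 ?_ ?_
    · refine (han.differentiableOn.mono ?_).diffContOnCl
      exact (closure_ball_subset_closedBall).trans hsub
    · intro z hz
      exact hM z (hsub (sphere_subset_closedBall hz))
  have hM0 : 0 ≤ M := (norm_nonneg _).trans (hM 0 (by simp))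
  refine IsBigO.of_bound (27 * M) ?_
  filter_upwards [eventually_ge_atTop 3] with n hn
  obtain ⟨k, rfl⟩ := Nat.exists_eq_add_of_le' hn
  have h := hb k
  have hk : (0 : ℝ) < k.factorial := by positivity
  have hfac : ((k + 3).factorial : ℝ) = (k + 3) * (k + 2) * (k + 1) * k.factorial := by
    simp only [Nat.factorial_succ]
    push_cast
    ring
  rw [norm_div, Complex.norm_natCast, hfac, norm_inv, norm_pow, Real.norm_natCast,
    div_le_iff₀ (by positivity)]
  push_cast
  have h3 : (1 : ℝ) ≤ 27 * ((k + 3 : ℝ) ^ 3)⁻¹ * ((k + 3) * (k + 2) * (k + 1)) := by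
    rw [← div_eq_mul_inv, div_mul_eq_mul_div, le_div_iff₀ (by positivity)]
    have : (0 : ℝ) ≤ k := by positivity
    nlinarith [pow_nonneg this 2, pow_nonneg this 3]
  calc _ ≤ _ := h
    _ = 1 * (k.factorial * M) := by ring
    _ ≤ (27 * ((k + 3 : ℝ) ^ 3)⁻¹ * ((k + 3) * (k + 2) * (k + 1))) * (k.factorial * M) := by
      gcongr
    _ = _ := by ring

open Metric in
/-- Singularity analysis for a function on the unit disc whose only singularity on the unit
circle is a square-root singularity at `1`. -/
theorem coeff_sub_isBigO_of_sqrt_singularity {f : ℂ → ℂ} (hf : AnalyticOnNhd ℂ f (ball 0 1))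
    (hbd : ∀ p : ℂ, ‖p‖ = 1 → p ≠ 1 → ∃ e : ℂ → ℂ, AnalyticAt ℂ e p ∧ f =ᶠ[𝓝[ball 0 1] p] e)
    {K : ℂ → ℂ} (hK : AnalyticAt ℂ K 0)
    (h1 : f =ᶠ[𝓝[ball 0 1] 1] fun u => K (sqrtOneSub u)) :
    (fun n => iteratedDeriv n f 0 / n.factorial - deriv K 0 * sqrtCoeff 1 n) =O[atTop]
      fun n : ℕ => -sqrtCoeff 1 n / (n : ℝ) := by
  obtain ⟨L, hL, hKL⟩ := hK.exists_eq_sum_add_pow_mul 7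
  set κ : ℕ → ℂ := fun i => iteratedDeriv i K 0 / i.factorial with hκ
  set P : ℂ → ℂ := fun u => ∑ i ∈ Finset.range 7, κ i * sqrtOneSub u ^ i with hP
  have hPan : ∀ p, 1 - p ∈ Complex.slitPlane → AnalyticAt ℂ P p := by
    intro p hp
    refine Finset.analyticAt_fun_sum _ fun i _ => ?_
    exact analyticAt_const.mul ((analyticAt_sqrtOneSub hp).pow i)
  have hslit : ∀ u ∈ ball (0 : ℂ) 1, 1 - u ∈ Complex.slitPlane := by
    intro u hu
    have hu' : ‖u‖ < 1 := by simpa using hu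
    exact one_sub_mem_slitPlane hu'.le (by rintro rfl; simp at hu')
  have hr : AnalyticOnNhd ℂ (f - P) (ball 0 1) := fun u hu => (hf u hu).sub (hPan u (hslit u hu))
  obtain ⟨M, hM⟩ := exists_bound_iteratedDeriv hr (by
    intro p hp hp1
    obtain ⟨e, he, hfe⟩ := hbd p hp hp1
    exact ⟨e - P, he.sub (hPan p (one_sub_mem_slitPlane hp.le hp1)), hfe.sub EventuallyEq.rfl⟩)
    hL (by
      filter_upwards [h1] with u hu
      rw [Pi.sub_apply, hu, hKL]
      simp only [hP, hκ, smul_eq_mul]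
      rw [add_comm, add_sub_assoc, add_eq_left, sub_eq_zero]
      exact Finset.sum_congr rfl fun i _ => by ring)
  have h3 := coeff_isBigO_of_bound_iteratedDeriv hr hM
  have hcoef : ∀ n, iteratedDeriv n f 0 / n.factorial =
      iteratedDeriv n (f - P) 0 / n.factorial + ∑ i ∈ Finset.range 7, κ i * sqrtCoeff i n := by
    intro n
    have h0 : (0 : ℂ) ∈ ball (0 : ℂ) 1 := by simp
    have hs : ∀ i, ContDiffAt ℂ n (fun u => sqrtOneSub u ^ i) 0 := fun i =>
      ((analyticAt_sqrtOneSub (hslit 0 h0)).pow i).contDiffAt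
    rw [iteratedDeriv_sub (hf 0 h0).contDiffAt (hPan 0 (hslit 0 h0)).contDiffAt, hP,
      iteratedDeriv_fun_sum fun i _ => contDiffAt_const.mul (hs i), sub_div, Finset.sum_div]
    have : ∀ i ∈ Finset.range 7, iteratedDeriv n (fun u => κ i * sqrtOneSub u ^ i) 0 /
        n.factorial = κ i * sqrtCoeff i n := by
      intro i _
      rw [iteratedDeriv_const_mul_field, mul_div_assoc, iteratedDeriv_sqrtOneSub_pow]
    rw [Finset.sum_congr rfl this]
    ring
  have hκ1 : κ 1 = deriv K 0 := by simp [hκ]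
  have h4 : (fun n : ℕ => ((n : ℝ) ^ 3)⁻¹) =O[atTop] fun n : ℕ => -sqrtCoeff 1 n / (n : ℝ) := by
    refine IsBigO.of_bound 2 ?_
    filter_upwards [eventually_gt_atTop 0] with n hn
    have hn' : (0 : ℝ) < n := by exact_mod_cast hn
    have h := inv_sq_le_sqrtCoeff hn
    rw [Real.norm_of_nonneg (by positivity), Real.norm_of_nonneg
      (div_nonneg (neg_sqrtCoeff_pos hn).le hn'.le), ← mul_div_assoc, le_div_iff₀ hn']
    calc ((n : ℝ) ^ 3)⁻¹ * n = 2 * (1 / 2 / (n : ℝ) ^ 2) := by field_simp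
      _ ≤ _ := by gcongr
  have h5 : (fun n => (κ 3 * sqrtCoeff 3 n + κ 5 * sqrtCoeff 5 n : ℂ)) =O[atTop]
      fun n : ℕ => -sqrtCoeff 1 n / (n : ℝ) := by
    have aux : ∀ j, (fun n => (sqrtCoeff (2 * j + 3) n : ℂ)) =O[atTop]
      fun n : ℕ => -sqrtCoeff 1 n / (n : ℝ) := fun j =>
        (isBigO_norm_left.1 (by simpa using (sqrtCoeff_odd_isBigO j).norm_left))
    exact ((aux 0).const_mul_left _).add ((aux 1).const_mul_left _)
  refine ((h3.trans h4).add h5).congr' ?_ EventuallyEq.rfl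
  filter_upwards [eventually_gt_atTop 3] with n hn
  have e0 : sqrtCoeff 0 n = 0 := sqrtCoeff_even (j := 0) (by lia)
  have e2 : sqrtCoeff 2 n = 0 := sqrtCoeff_even (j := 1) (by lia)
  have e4 : sqrtCoeff 4 n = 0 := sqrtCoeff_even (j := 2) (by lia)
  have e6 : sqrtCoeff 6 n = 0 := sqrtCoeff_even (j := 3) (by lia)
  rw [hcoef n]
  simp only [Finset.sum_range_succ, Finset.sum_range_zero, e0, e2, e4, e6, hκ1]
  push_cast
  ring

/-! ### Square-root singularities of implicitly defined functions -/

theorem exists_analytic_implicit {H : ℂ × ℂ → ℂ} {x y : ℂ} (hH : AnalyticAt ℂ H (x, y))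
    (hd : deriv (fun v => H (x, v)) y ≠ 0) :
    ∃ χ : ℂ → ℂ, AnalyticAt ℂ χ x ∧ χ x = y ∧
      (∀ᶠ q in 𝓝 (x, y), H q = H (x, y) → χ q.1 = q.2) ∧
      ∀ᶠ v in 𝓝 x, H (v, χ v) = H (x, y) := by
  have hc : ContDiffAt ℂ (⊤ : WithTop ℕ∞) H (x, y) := hH.contDiffAt
  have hfd : HasFDerivAt H (fderiv ℂ H (x, y)) (x, y) := hH.differentiableAt.hasFDerivAt
  have hcomp : HasDerivAt (fun v => H (x, v)) (fderiv ℂ H (x, y) (0, 1)) y :=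
    hfd.comp_hasDerivAt y ((hasDerivAt_const y x).prodMk (hasDerivAt_id y))
  rw [hcomp.deriv] at hd
  have hinv : (fderiv ℂ H (x, y) ∘SL ContinuousLinearMap.inr ℂ ℂ ℂ).IsInvertible := by
    refine ⟨ContinuousLinearEquiv.unitsEquivAut ℂ (Units.mk0 _ hd), ?_⟩
    ext
    simp
  refine ⟨hc.implicitFunction (by simp) hinv,
    (hc.contDiffAt_implicitFunction (by simp) hinv).analyticAt,
    hc.implicitFunction_apply_self (by simp) hinv, ?_, ?_⟩
  · filter_upwards [hc.eventually_apply_eq_iff_implicitFunction (by simp) hinv] with q hq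
    exact hq.1
  · exact hc.eventually_apply_implicitFunction (by simp) hinv

theorem exists_analytic_sqrt {e : ℂ → ℂ} {p : ℂ} (he : AnalyticAt ℂ e p) (h0 : e p = 0)
    (h1 : deriv e p = 0) (h2 : deriv (deriv e) p ≠ 0) :
    ∃ h : ℂ → ℂ, AnalyticAt ℂ h p ∧ h p = 0 ∧ deriv h p ≠ 0 ∧ ∀ v, h v ^ 2 = e v := by
  have he' : AnalyticAt ℂ (fun t => e (p + t)) 0 := by
    refine AnalyticAt.fun_comp (g := e) (f := fun t => p + t) ?_ (by fun_prop)
    simpa using he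
  obtain ⟨F, hF, hFe⟩ := he'.exists_eq_sum_add_pow_mul 3
  have d1 : deriv (fun t => e (p + t)) = fun t => deriv e (p + t) := by
    ext t
    exact deriv_comp_const_add (f := e) p t
  have d2 : deriv (fun t => deriv e (p + t)) 0 = deriv (deriv e) p := by
    rw [deriv_comp_const_add (f := deriv e) p 0, add_zero]
  simp only [Finset.sum_range_succ, Finset.sum_range_zero, iteratedDeriv_succ, iteratedDeriv_zero,
    d1, d2, add_zero, h0, h1, smul_eq_mul, mul_zero, zero_add] at hFe
  set a := deriv (deriv e) p / 2 with ha
  have ha0 : a ≠ 0 := div_ne_zero h2 two_ne_zero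
  have hev : ∀ v, e v = (v - p) ^ 2 * (a + (v - p) * F (v - p)) := by
    intro v
    have := hFe (v - p)
    rw [show p + (v - p) = v by ring] at this
    rw [this, ha]
    simp
    ring
  set α := a ^ (1 / 2 : ℂ) with hα
  have hsq : ∀ x : ℂ, (x ^ (1 / 2 : ℂ)) ^ 2 = x := fun x => by simp [one_div]
  have hFp : AnalyticAt ℂ (fun v => F (v - p)) p := by
    refine AnalyticAt.fun_comp (g := F) (f := fun t => t - p) ?_ (by fun_prop)
    simpa using hF
  have hqa : AnalyticAt ℂ (fun v => ((a + (v - p) * F (v - p)) / a) ^ (1 / 2 : ℂ)) p := by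
    refine AnalyticAt.cpow ?_ analyticAt_const (by simp [ha0])
    exact (analyticAt_const.add ((analyticAt_id.sub analyticAt_const).mul hFp)).div
      analyticAt_const ha0
  have hha : HasDerivAt (fun v => (v - p) * (α * ((a + (v - p) * F (v - p)) / a) ^ (1 / 2 : ℂ)))
      (1 * (α * ((a + (p - p) * F (p - p)) / a) ^ (1 / 2 : ℂ)) +
        (p - p) * deriv (fun v => α * ((a + (v - p) * F (v - p)) / a) ^ (1 / 2 : ℂ)) p) p :=
    ((hasDerivAt_id p).sub_const p).mul (analyticAt_const.mul hqa).differentiableAt.hasDerivAt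
  refine ⟨fun v => (v - p) * (α * ((a + (v - p) * F (v - p)) / a) ^ (1 / 2 : ℂ)), ?_, ?_, ?_, ?_⟩
  · exact ((analyticAt_id.sub analyticAt_const).mul (analyticAt_const.mul hqa))
  · simp
  · rw [hha.deriv]
    simp [ha0, hα]
  · intro v
    rw [mul_pow, mul_pow, hα, hsq, hsq, hev]
    field_simp

theorem exists_local_sqrt_param {Φ G : ℂ → ℂ} {ρ U₀ : ℂ} {d : ℕ} (hd : d ≠ 0) (hρ : ρ ≠ 0)
    (hΦ : AnalyticAt ℂ Φ U₀) (hG : AnalyticAt ℂ G ρ) (heq : U₀ = ρ * Φ U₀ + G ρ)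
    (h1 : ρ * deriv Φ U₀ = 1) (h2 : deriv (deriv Φ) U₀ ≠ 0) (h3 : Φ U₀ + deriv G ρ ≠ 0) :
    ∃ h k : ℂ → ℂ, AnalyticAt ℂ h U₀ ∧ AnalyticAt ℂ k 0 ∧ k 0 = U₀ ∧ deriv k 0 ≠ 0 ∧
      ∀ᶠ q in 𝓝 (ρ, U₀), q.2 = q.1 * Φ q.2 + G q.1 →
        h q.2 ^ 2 = 1 - (q.1 / ρ) ^ d ∧ k (h q.2) = q.2 := by
  have hH : AnalyticAt ℂ (fun q : ℂ × ℂ => q.1 - (q.2 * Φ q.1 + G q.2)) (U₀, ρ) := by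
    refine analyticAt_fst.sub ((analyticAt_snd.mul ?_).add ?_)
    · exact AnalyticAt.fun_comp (g := Φ) (f := Prod.fst) hΦ analyticAt_fst
    · exact AnalyticAt.fun_comp (g := G) (f := Prod.snd) hG analyticAt_snd
  have hHd : HasDerivAt (fun z => U₀ - (z * Φ U₀ + G z)) (-(1 * Φ U₀ + deriv G ρ)) ρ :=
    (((hasDerivAt_id ρ).mul_const (Φ U₀)).add hG.differentiableAt.hasDerivAt).const_sub U₀
  obtain ⟨ψ, hψ, hψ0, hψ1, hψ2⟩ := exists_analytic_implicit hH (by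
    change deriv (fun z => U₀ - (z * Φ U₀ + G z)) ρ ≠ 0
    rw [hHd.deriv]
    rw [one_mul]
    exact neg_ne_zero.2 h3)
  have hval : U₀ - (ρ * Φ U₀ + G ρ) = 0 := by linear_combination heq
  simp only [hval] at hψ1 hψ2
  have hN : ∀ᶠ v in 𝓝 U₀, deriv ψ v * (Φ v + deriv G (ψ v)) = 1 - ψ v * deriv Φ v := by
    have hG' : ∀ᶠ v in 𝓝 U₀, AnalyticAt ℂ G (ψ v) :=
      hψ.continuousAt.eventually (by rw [hψ0]; exact hG.eventually_analyticAt)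
    filter_upwards [eventually_eventually_nhds.2 hψ2, hψ.eventually_analyticAt,
      hΦ.eventually_analyticAt, hG'] with v e1 e2 e3 e4
    have hd1 : HasDerivAt (fun v => v - (ψ v * Φ v + G (ψ v)))
        (1 - (deriv ψ v * Φ v + ψ v * deriv Φ v + deriv G (ψ v) * deriv ψ v)) v :=
      (hasDerivAt_id v).sub ((e2.differentiableAt.hasDerivAt.mul
        e3.differentiableAt.hasDerivAt).add
        (e4.differentiableAt.hasDerivAt.comp v e2.differentiableAt.hasDerivAt))
    have hd2 : HasDerivAt (fun v => v - (ψ v * Φ v + G (ψ v))) 0 v :=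
      (hasDerivAt_const v (0 : ℂ)).congr_of_eventuallyEq e1
    have := hd1.unique hd2
    linear_combination -this
  have hψ' : deriv ψ U₀ = 0 := by
    have := hN.self_of_nhds
    rw [hψ0, h1, sub_self] at this
    exact (mul_eq_zero.1 this).resolve_right h3
  have hDa : AnalyticAt ℂ (fun v => Φ v + deriv G (ψ v)) U₀ := by
    refine hΦ.add (AnalyticAt.fun_comp (g := deriv G) (f := ψ) ?_ hψ)
    rw [hψ0]
    exact hG.deriv
  have hψ'' : deriv (deriv ψ) U₀ ≠ 0 := by
    have e1 : HasDerivAt (fun v => deriv ψ v * (Φ v + deriv G (ψ v)))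
        (deriv (deriv ψ) U₀ * (Φ U₀ + deriv G (ψ U₀)) +
          deriv ψ U₀ * deriv (fun v => Φ v + deriv G (ψ v)) U₀) U₀ :=
      hψ.deriv.differentiableAt.hasDerivAt.mul hDa.differentiableAt.hasDerivAt
    have e2 : HasDerivAt (fun v => 1 - ψ v * deriv Φ v)
        (-(deriv ψ U₀ * deriv Φ U₀ + ψ U₀ * deriv (deriv Φ) U₀)) U₀ :=
      (hψ.differentiableAt.hasDerivAt.mul hΦ.deriv.differentiableAt.hasDerivAt).const_sub 1
    have e3 := e1.unique (e2.congr_of_eventuallyEq hN)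
    intro h0
    rw [hψ', h0, hψ0] at e3
    refine mul_ne_zero hρ h2 ?_
    linear_combination e3
  have hea : AnalyticAt ℂ (fun v => 1 - (ψ v / ρ) ^ d) U₀ := by fun_prop (disch := exact hρ)
  have hed : ∀ᶠ v in 𝓝 U₀, deriv (fun v => 1 - (ψ v / ρ) ^ d) v =
      -(d * (ψ v / ρ) ^ (d - 1)) * (deriv ψ v / ρ) := by
    filter_upwards [hψ.eventually_analyticAt] with v e2
    have : HasDerivAt (fun v => 1 - (ψ v / ρ) ^ d)
        (-(d * (ψ v / ρ) ^ (d - 1) * (deriv ψ v / ρ))) v :=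
      ((e2.differentiableAt.hasDerivAt.div_const ρ).pow d).const_sub 1
    rw [this.deriv]
    ring
  have hed2 : deriv (deriv (fun v => 1 - (ψ v / ρ) ^ d)) U₀ ≠ 0 := by
    rw [EventuallyEq.deriv_eq hed]
    have ha : AnalyticAt ℂ (fun v => -(d * (ψ v / ρ) ^ (d - 1))) U₀ := by
      fun_prop (disch := exact hρ)
    have : HasDerivAt (fun v => -(d * (ψ v / ρ) ^ (d - 1)) * (deriv ψ v / ρ))
        (deriv (fun v => -(d * (ψ v / ρ) ^ (d - 1))) U₀ * (deriv ψ U₀ / ρ) +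
          -(d * (ψ U₀ / ρ) ^ (d - 1)) * (deriv (deriv ψ) U₀ / ρ)) U₀ :=
      ha.differentiableAt.hasDerivAt.mul (hψ.deriv.differentiableAt.hasDerivAt.div_const ρ)
    rw [this.deriv, hψ', hψ0, div_self hρ]
    simp [hd, hψ'', hρ]
  obtain ⟨h, hha, hh0, hh1, hh2⟩ := exists_analytic_sqrt hea (by simp [hψ0, div_self hρ])
    (by rw [hed.self_of_nhds, hψ']; simp) hed2
  have hKa : AnalyticAt ℂ (fun q : ℂ × ℂ => h q.2 - q.1) (0, U₀) :=
    (AnalyticAt.fun_comp (g := h) (f := Prod.snd) hha analyticAt_snd).sub analyticAt_fst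
  obtain ⟨k, hk, hk0, hk1, -⟩ := exists_analytic_implicit hKa (by simpa using hh1)
  have hkh : ∀ᶠ v in 𝓝 U₀, k (h v) = v := by
    have ht : Tendsto (fun v => (h v, v)) (𝓝 U₀) (𝓝 (0, U₀)) := by
      have := hha.continuousAt.tendsto.prodMk_nhds (tendsto_id (x := 𝓝 U₀))
      rwa [hh0] at this
    filter_upwards [ht.eventually hk1] with v hv
    exact hv (by simp [hh0])
  refine ⟨h, k, hha, hk, hk0, ?_, ?_⟩
  · have hk' : HasDerivAt k (deriv k 0) (h U₀) := by
      rw [hh0]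
      exact hk.differentiableAt.hasDerivAt
    have e1 := hk'.comp U₀ hha.differentiableAt.hasDerivAt
    have e2 := e1.unique ((hasDerivAt_id U₀).congr_of_eventuallyEq hkh)
    intro h0
    simp [h0] at e2
  · have hs : Tendsto (fun q : ℂ × ℂ => (q.2, q.1)) (𝓝 (ρ, U₀)) (𝓝 (U₀, ρ)) :=
      (continuous_swap.tendsto (ρ, U₀))
    have hs2 : Tendsto (fun q : ℂ × ℂ => q.2) (𝓝 (ρ, U₀)) (𝓝 U₀) := continuous_snd.tendsto (ρ, U₀)
    filter_upwards [hs.eventually hψ1, hs2.eventually hkh] with q q1 q2 q3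
    refine ⟨?_, q2⟩
    rw [hh2, q1 (by linear_combination q3)]

theorem exists_local_analytic_solution {Φ G : ℂ → ℂ} {z₀ U₀ : ℂ}
    (hΦ : AnalyticAt ℂ Φ U₀) (hG : AnalyticAt ℂ G z₀) (heq : U₀ = z₀ * Φ U₀ + G z₀)
    (h1 : z₀ * deriv Φ U₀ ≠ 1) :
    ∃ χ : ℂ → ℂ, AnalyticAt ℂ χ z₀ ∧ χ z₀ = U₀ ∧
      ∀ᶠ q in 𝓝 (z₀, U₀), q.2 = q.1 * Φ q.2 + G q.1 → χ q.1 = q.2 := by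
  have hH : AnalyticAt ℂ (fun q : ℂ × ℂ => q.2 - (q.1 * Φ q.2 + G q.1)) (z₀, U₀) := by
    refine analyticAt_snd.sub ((analyticAt_fst.mul ?_).add ?_)
    · exact AnalyticAt.fun_comp (g := Φ) (f := Prod.snd) hΦ analyticAt_snd
    · exact AnalyticAt.fun_comp (g := G) (f := Prod.fst) hG analyticAt_fst
  have hHd : HasDerivAt (fun v => v - (z₀ * Φ v + G z₀)) (1 - z₀ * deriv Φ U₀) U₀ :=
    (hasDerivAt_id U₀).sub ((hΦ.differentiableAt.hasDerivAt.const_mul z₀).add_const (G z₀))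
  obtain ⟨χ, hχ, hχ0, hχ1, -⟩ := exists_analytic_implicit hH (by
    change deriv (fun v => v - (z₀ * Φ v + G z₀)) U₀ ≠ 0
    rw [hHd.deriv]
    exact sub_ne_zero.2 h1.symm)
  refine ⟨χ, hχ, hχ0, ?_⟩
  filter_upwards [hχ1] with q h2 h3
  exact h2 (by linear_combination h3 - heq)

open Metric in
/-- Coefficient asymptotics for `f`, where `f ((z / ρ) ^ d) = Φ (U z)` and
`U z = z * Φ (U z) + G z`, in the critical case `ρ * Φ' (U ρ) = 1`. -/
theorem exists_coeff_isBigO_of_critical {Φ G U f : ℂ → ℂ} {ρ : ℝ} {d : ℕ} (hd : d ≠ 0)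
    (hρ : 0 < ρ) (hUc : ContinuousOn U (closedBall 0 ρ))
    (hΦ : ∀ z ∈ closedBall (0 : ℂ) ρ, AnalyticAt ℂ Φ (U z))
    (hG : ∀ z ∈ closedBall (0 : ℂ) ρ, AnalyticAt ℂ G z)
    (heq : ∀ z ∈ closedBall (0 : ℂ) ρ, U z = z * Φ (U z) + G z)
    (hreg : ∀ z : ℂ, ‖z‖ = ρ → (z / ρ) ^ d ≠ 1 → z * deriv Φ (U z) ≠ 1)
    (h1 : ρ * deriv Φ (U ρ) = 1) (h2 : deriv (deriv Φ) (U ρ) ≠ 0)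
    (h3 : Φ (U ρ) + deriv G ρ ≠ 0)
    (hf : AnalyticOnNhd ℂ f (ball 0 1))
    (hfU : ∀ z ∈ ball (0 : ℂ) ρ, f ((z / ρ) ^ d) = Φ (U z)) :
    ∃ c : ℂ, c ≠ 0 ∧ (fun n => iteratedDeriv n f 0 / n.factorial - c * sqrtCoeff 1 n) =O[atTop]
      fun n : ℕ => -sqrtCoeff 1 n / (n : ℝ) := by
  have hρ' : (ρ : ℂ) ≠ 0 := by exact_mod_cast hρ.ne'
  have hroot : ∀ x : ℂ, (x ^ (1 / d : ℂ)) ^ d = x := fun x => by simp [one_div, hd]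
  have hbranch : ∀ p : ℂ, ‖p‖ = 1 → ∃ z : ℂ → ℂ, AnalyticAt ℂ z p ∧ ‖z p‖ = ρ ∧
      (∀ u, (z u / ρ) ^ d = u) ∧ (∀ u ∈ ball (0 : ℂ) 1, z u ∈ ball (0 : ℂ) ρ) ∧
      (p = 1 → z p = ρ) ∧ ∀ u, u / p ∈ Complex.slitPlane → ContinuousAt z u := by
    intro p hp
    have hp0 : p ≠ 0 := by rintro rfl; simp at hp
    set z : ℂ → ℂ := fun u => ρ * p ^ (1 / d : ℂ) * (u / p) ^ (1 / d : ℂ) with hz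
    have hzd : ∀ u, (z u / ρ) ^ d = u := by
      intro u
      have : z u / ρ = p ^ (1 / d : ℂ) * (u / p) ^ (1 / d : ℂ) := by
        rw [hz]
        field_simp
      rw [this, mul_pow, hroot, hroot, mul_div_cancel₀ _ hp0]
    have hnorm : ∀ u, (‖z u‖ / ρ) ^ d = ‖u‖ := by
      intro u
      rw [← hzd u, norm_pow, norm_div, hzd u, Complex.norm_real, Real.norm_of_nonneg hρ.le]
    have han : ∀ u, u / p ∈ Complex.slitPlane → AnalyticAt ℂ z u := by
      intro u hu
      refine analyticAt_const.mul (AnalyticAt.cpow ?_ analyticAt_const hu)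
      fun_prop (disch := exact hp0)
    refine ⟨z, han p (by simp [hp0]), ?_, hzd, ?_, ?_, fun u hu => (han u hu).continuousAt⟩
    · have := hnorm p
      rw [hp, pow_eq_one_iff_of_nonneg (by positivity) hd, div_eq_one_iff_eq hρ.ne'] at this
      exact this
    · intro u hu
      have hu' : ‖u‖ < 1 := by simpa using hu
      rw [← hnorm u, pow_lt_one_iff_of_nonneg (by positivity) hd, div_lt_one hρ] at hu'
      simpa using hu'
    · rintro rfl
      simp [hz]
  have hlim : ∀ p : ℂ, ∀ z : ℂ → ℂ, AnalyticAt ℂ z p → ‖z p‖ = ρ →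
      (∀ u ∈ ball (0 : ℂ) 1, z u ∈ ball (0 : ℂ) ρ) →
      Tendsto (fun u => (z u, U (z u))) (𝓝[ball 0 1] p) (𝓝 (z p, U (z p))) := by
    intro p z hz hzp hzb
    have e1 : Tendsto z (𝓝[ball 0 1] p) (𝓝 (z p)) :=
      hz.continuousAt.tendsto.mono_left nhdsWithin_le_nhds
    refine e1.prodMk_nhds ?_
    refine (hUc (z p) (by simp [hzp])).tendsto.comp ?_
    refine tendsto_nhdsWithin_iff.2 ⟨e1, ?_⟩
    filter_upwards [self_mem_nhdsWithin] with u hu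
    exact ball_subset_closedBall (hzb u hu)
  have hbd : ∀ p : ℂ, ‖p‖ = 1 → p ≠ 1 →
      ∃ e : ℂ → ℂ, AnalyticAt ℂ e p ∧ f =ᶠ[𝓝[ball 0 1] p] e := by
    intro p hp hp1
    obtain ⟨z, hz, hzp, hzd, hzb, -, -⟩ := hbranch p hp
    have hmem : z p ∈ closedBall (0 : ℂ) ρ := by simp [hzp]
    obtain ⟨χ, hχ, hχ0, hχ1⟩ := exists_local_analytic_solution (hΦ _ hmem) (hG _ hmem)
      (heq _ hmem) (hreg _ hzp (by rwa [hzd]))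
    refine ⟨fun u => Φ (χ (z u)), ?_, ?_⟩
    · refine AnalyticAt.fun_comp (g := Φ) (f := fun u => χ (z u)) ?_ (AnalyticAt.fun_comp hχ hz)
      rw [hχ0]
      exact hΦ _ hmem
    · filter_upwards [(hlim p z hz hzp hzb).eventually hχ1, self_mem_nhdsWithin] with u hu hub
      have e := hu (heq _ (ball_subset_closedBall (hzb u hub)))
      rw [e, ← hfU _ (hzb u hub), hzd]
  have hmem : (ρ : ℂ) ∈ closedBall (0 : ℂ) ρ := by simp [abs_of_pos hρ]
  obtain ⟨h, k, hh, hk, hk0, hk1, hhk⟩ := exists_local_sqrt_param hd hρ' (hΦ _ hmem) (hG _ hmem)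
    (heq _ hmem) h1 h2 h3
  obtain ⟨z, hz, hzp, hzd, hzb, hz1, hzc⟩ := hbranch 1 (by simp)
  have hz1 := hz1 rfl
  have hl := hlim 1 z hz hzp hzb
  rw [hz1] at hl
  have hhan : ∀ᶠ q : ℂ × ℂ in 𝓝 ((ρ : ℂ), U ρ), AnalyticAt ℂ h q.2 :=
    (continuous_snd.tendsto ((ρ : ℂ), U ρ)).eventually hh.eventually_analyticAt
  obtain ⟨ε, hε, hball⟩ := Metric.mem_nhdsWithin_iff.1 (hl.eventually (hhk.and hhan))
  set s : Set ℂ := ball 1 (min ε 1) ∩ ball 0 1 with hs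
  have hsε : ∀ u ∈ s, u ∈ ball (1 : ℂ) ε ∩ ball 0 1 := fun u hu =>
    ⟨ball_subset_ball (min_le_left _ _) hu.1, hu.2⟩
  have hprop : ∀ u ∈ s, h (U (z u)) ^ 2 = 1 - u ∧ k (h (U (z u))) = U (z u) ∧
      AnalyticAt ℂ h (U (z u)) := by
    intro u hu
    obtain ⟨q1, q2⟩ := hball (hsε u hu)
    have q3 := q1 (heq _ (ball_subset_closedBall (hzb u hu.2)))
    simp only [hzd] at q3
    exact ⟨q3.1, q3.2, q2⟩
  have hslit : ∀ u ∈ s, 1 - u ∈ Complex.slitPlane := by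
    intro u hu
    have hu' : ‖u‖ < 1 := by simpa using hu.2
    exact one_sub_mem_slitPlane hu'.le (by rintro rfl; simp at hu')
  have hcont1 : ContinuousOn (fun u => h (U (z u))) s := by
    intro u hu
    have hu1 : dist u 1 < 1 := lt_of_lt_of_le hu.1 (min_le_right _ _)
    have hzu : ContinuousAt z u := by
      refine hzc u ?_
      have : u = 1 + (u - 1) := by ring
      rw [div_one, this]
      exact Complex.mem_slitPlane_of_norm_lt_one (by simpa [dist_eq_norm] using hu1)
    have hUu : ContinuousAt U (z u) :=
      (hUc.mono ball_subset_closedBall).continuousAt (isOpen_ball.mem_nhds (hzb u hu.2))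
    have hcomp : ContinuousAt (fun v => U (z v)) u := ContinuousAt.comp' hUu hzu
    exact (ContinuousAt.comp' (f := fun v => U (z v)) (hprop u hu).2.2.continuousAt
      hcomp).continuousWithinAt
  have hcont2 : ContinuousOn sqrtOneSub s := fun u hu =>
    (analyticAt_sqrtOneSub (hslit u hu)).continuousAt.continuousWithinAt
  have hpre : IsPreconnected s := ((convex_ball _ _).inter (convex_ball _ _)).isPreconnected
  have hsq : Set.EqOn ((fun u => h (U (z u))) ^ 2) (sqrtOneSub ^ 2) s := by
    intro u hu
    simp only [Pi.pow_apply]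
    rw [(hprop u hu).1, sqrtOneSub_sq]
  have hne : ∀ {u : ℂ}, u ∈ s → sqrtOneSub u ≠ 0 := by
    intro u hu
    exact sqrtOneSub_ne_zero (by rintro rfl; simpa using hu.2)
  have hsmem : s ∈ 𝓝[ball 0 1] (1 : ℂ) :=
    inter_mem (mem_nhdsWithin_of_mem_nhds (ball_mem_nhds _ (by positivity))) self_mem_nhdsWithin
  have hsign : ∃ σ : ℂ, σ ≠ 0 ∧ ∀ u ∈ s, h (U (z u)) = σ * sqrtOneSub u := by
    rcases hpre.eq_or_eq_neg_of_sq_eq hcont1 hcont2 hsq hne with h | h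
    · exact ⟨1, one_ne_zero, fun u hu => by simpa using h hu⟩
    · exact ⟨-1, by simp, fun u hu => by simpa using h hu⟩
  obtain ⟨σ, hσ, hσs⟩ := hsign
  have hkσ : AnalyticAt ℂ (fun t => k (σ * t)) 0 := by
    refine AnalyticAt.fun_comp (g := k) (f := fun t => σ * t) ?_ (by fun_prop)
    simpa using hk
  have hK : AnalyticAt ℂ (fun t => Φ (k (σ * t))) 0 := by
    refine AnalyticAt.fun_comp (g := Φ) (f := fun t => k (σ * t)) ?_ hkσ
    simpa [hk0] using hΦ _ hmem
  refine ⟨deriv (fun t => Φ (k (σ * t))) 0, ?_, coeff_sub_isBigO_of_sqrt_singularity hf hbd hK ?_⟩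
  · have e1 : HasDerivAt (fun t => σ * t) σ (0 : ℂ) := by
      simpa using (hasDerivAt_id (0 : ℂ)).const_mul σ
    have e2 : HasDerivAt k (deriv k 0) (σ * 0) := by
      simpa using hk.differentiableAt.hasDerivAt
    have e3 : HasDerivAt Φ (deriv Φ (U ρ)) (k (σ * 0)) := by
      simpa [hk0] using (hΦ _ hmem).differentiableAt.hasDerivAt
    have e4 : HasDerivAt (fun t => Φ (k (σ * t))) _ 0 := e3.comp 0 (e2.comp 0 e1)
    rw [e4.deriv]
    refine mul_ne_zero ?_ (mul_ne_zero hk1 hσ)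
    intro h0
    simp [h0] at h1
  · filter_upwards [hsmem] with u hu
    rw [← hσs u hu, (hprop u hu).2.1, ← hfU _ (hzb u hu.2), hzd]

section

/-! ### Power series with real coefficients -/

theorem summable_of_lt_radius {a : ℕ → ℝ} {x : ℝ} (hx : 0 ≤ x)
    (h : ENNReal.ofReal x < radius a) : Summable fun n => |a n| * x ^ n := by
  have := (FormalMultilinearSeries.ofScalars ℝ a).summable_norm_mul_pow h
  simpa [FormalMultilinearSeries.ofScalars_norm, Real.coe_toNNReal _ hx] using this

theorem le_radius_of_summable_abs {a : ℕ → ℝ} {x : ℝ} (hx : 0 ≤ x)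
    (h : Summable fun n => |a n| * x ^ n) : ENNReal.ofReal x ≤ radius a := by
  refine (FormalMultilinearSeries.ofScalars ℝ a).le_radius_of_summable (r := x.toNNReal) ?_
  simpa [FormalMultilinearSeries.ofScalars_norm, Real.coe_toNNReal _ hx] using h

theorem le_radius_of_summable {a : ℕ → ℝ} (ha : ∀ n, 0 ≤ a n) {x : ℝ} (hx : 0 ≤ x)
    (h : Summable fun n => a n * x ^ n) : ENNReal.ofReal x ≤ radius a :=
  le_radius_of_summable_abs hx (by simpa only [abs_of_nonneg (ha _)] using h)

theorem summable_of_nonneg_of_lt_radius {a : ℕ → ℝ} (ha : ∀ n, 0 ≤ a n) {x : ℝ} (hx : 0 ≤ x)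
    (h : ENNReal.ofReal x < radius a) : Summable fun n => a n * x ^ n := by
  simpa only [abs_of_nonneg (ha _)] using summable_of_lt_radius hx h

theorem radius_anti {a b : ℕ → ℝ} {C : ℝ} (h : ∀ n, |a n| ≤ C * |b n|) :
    radius b ≤ radius a := by
  refine le_of_forall_lt fun c hc => ?_
  obtain ⟨x, hcx, hxb⟩ := ENNReal.lt_iff_exists_nnreal_btwn.1 hc
  refine hcx.trans_le ?_
  have hs := summable_of_lt_radius (a := b) x.2 (by simpa using hxb)
  rw [← ENNReal.ofReal_coe_nnreal]
  refine le_radius_of_summable_abs x.2 ?_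
  refine (hs.mul_left C).of_nonneg_of_le (fun n => by positivity) fun n => ?_
  rw [← mul_assoc]
  exact mul_le_mul_of_nonneg_right (h n) (by positivity)

/-- The coefficients of the derivative of `∑ a_n z^n`. -/
def dcoeff (a : ℕ → ℝ) (n : ℕ) : ℝ := (n + 1) * a (n + 1)

theorem dcoeff_nonneg {a : ℕ → ℝ} (ha : ∀ n, 0 ≤ a n) (n : ℕ) : 0 ≤ dcoeff a n :=
  mul_nonneg (by positivity) (ha _)

theorem exists_lt_of_ofReal_lt {x : ℝ} {R : ℝ≥0∞} (h : ENNReal.ofReal x < R) :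
    ∃ y, x < y ∧ 0 < y ∧ ENNReal.ofReal y < R := by
  obtain ⟨y, h1, h2⟩ := ENNReal.lt_iff_exists_nnreal_btwn.1 h
  have hy : (0 : ℝ) < y := by
    have := (zero_le : 0 ≤ ENNReal.ofReal x).trans_lt h1
    exact_mod_cast this
  refine ⟨y, ?_, hy, by simpa using h2⟩
  rw [← ENNReal.ofReal_coe_nnreal] at h1
  exact (ENNReal.ofReal_lt_ofReal_iff hy).1 h1

theorem summable_mul_pow_pred {a : ℕ → ℝ} {x : ℝ} (hx : 0 < x)
    (h : ENNReal.ofReal x < radius a) : Summable fun n : ℕ => |a n| * (n * x ^ (n - 1)) := by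
  obtain ⟨y, hxy, hy0, hy⟩ := exists_lt_of_ofReal_lt h
  have hs := summable_of_lt_radius hy0.le hy
  obtain ⟨C, hC⟩ := hs.tendsto_atTop_zero.bddAbove_range
  have hC' : ∀ n, |a n| * y ^ n ≤ C := fun n => hC ⟨n, rfl⟩
  have hg : Summable fun n : ℕ => (n : ℝ) ^ 1 * (x / y) ^ n :=
    summable_pow_mul_geometric_of_norm_lt_one 1
      (by rw [Real.norm_of_nonneg (by positivity), div_lt_one hy0]; exact hxy)
  refine (hg.mul_left (C / x)).of_nonneg_of_le (fun n => by positivity) fun n => ?_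
  rcases Nat.eq_zero_or_pos n with rfl | hn
  · simp
  · have : x ^ n = x * x ^ (n - 1) := by rw [← pow_succ', Nat.sub_add_cancel hn]
    have e : |a n| * (n * x ^ (n - 1)) = (|a n| * y ^ n) * (n * x ^ (n - 1) / y ^ n) := by
      field_simp
    rw [e]
    refine (mul_le_mul_of_nonneg_right (hC' n) (by positivity)).trans (le_of_eq ?_)
    rw [pow_one, div_pow, this]
    field_simp

theorem radius_le_radius_dcoeff (a : ℕ → ℝ) : radius a ≤ radius (dcoeff a) := by
  refine le_of_forall_lt fun c hc => ?_
  obtain ⟨x, hcx, hxb⟩ := ENNReal.lt_iff_exists_nnreal_btwn.1 hc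
  refine hcx.trans_le ?_
  rw [← ENNReal.ofReal_coe_nnreal] at hxb ⊢
  rcases x.2.eq_or_lt with h0 | h0
  · have : (x : ℝ) = 0 := h0.symm
    simp [this]
  have hs := summable_mul_pow_pred h0 hxb
  refine le_radius_of_summable_abs x.2 ?_
  have := (summable_nat_add_iff 1).2 hs
  refine this.congr fun n => ?_
  rw [dcoeff, abs_mul, abs_of_nonneg (by positivity : (0 : ℝ) ≤ n + 1)]
  simp
  ring

variable {𝕜 : Type*} [RCLike 𝕜]

/-- The sum of the power series `∑ a_n z^n`, over the reals or the complex numbers. -/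
def psum (a : ℕ → ℝ) (z : 𝕜) : 𝕜 := ∑' n, (a n : 𝕜) * z ^ n

theorem norm_coeff_mul_pow (a : ℕ → ℝ) (z : 𝕜) (n : ℕ) :
    ‖(a n : 𝕜) * z ^ n‖ = |a n| * ‖z‖ ^ n := by simp

theorem summable_psum {a : ℕ → ℝ} {z : 𝕜} (h : Summable fun n => |a n| * ‖z‖ ^ n) :
    Summable fun n => (a n : 𝕜) * z ^ n :=
  Summable.of_norm (by simpa only [norm_coeff_mul_pow] using h)

theorem generator_eq_psum (a : ℕ → ℝ) : generator a = psum a := by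
  ext x
  simp [generator, psum]

theorem psum_ofReal (a : ℕ → ℝ) (x : ℝ) : psum a (x : 𝕜) = (generator a x : 𝕜) := by
  rw [generator, RCLike.ofReal_tsum]
  simp [psum]

theorem hasDerivAt_psum {a : ℕ → ℝ} {z : 𝕜} (hz : ENNReal.ofReal ‖z‖ < radius a) :
    HasDerivAt (psum a : 𝕜 → 𝕜) (psum (dcoeff a) z) z := by
  obtain ⟨y, hzy, hy0, hy⟩ := exists_lt_of_ofReal_lt hz
  have hu := summable_mul_pow_pred hy0 hy
  have hmem : z ∈ Metric.ball (0 : 𝕜) y := by simpa using hzy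
  have h := hasDerivAt_tsum_of_isPreconnected (𝕜 := 𝕜) (g := fun n v => (a n : 𝕜) * v ^ n)
    (g' := fun n v => (a n : 𝕜) * (n * v ^ (n - 1))) (t := Metric.ball 0 y) (y₀ := z) (y := z) hu
    Metric.isOpen_ball (convex_ball (0 : 𝕜) y).isPreconnected
    (fun n v _ => (hasDerivAt_pow n v).const_mul _)
    (fun n v hv => ?_) hmem (summable_psum (summable_of_lt_radius (norm_nonneg z) hz)) hmem
  · have hs : Summable fun n => (a n : 𝕜) * (n * z ^ (n - 1)) := by
      refine Summable.of_norm_bounded hu fun n => ?_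
      rw [norm_mul, norm_mul, norm_pow, RCLike.norm_ofReal, RCLike.norm_natCast]
      gcongr
    have e : psum (dcoeff a) z = ∑' n : ℕ, (a n : 𝕜) * (n * z ^ (n - 1)) := by
      rw [hs.tsum_eq_zero_add, psum]
      simp only [Nat.cast_zero, zero_mul, mul_zero, zero_add]
      refine tsum_congr fun n => ?_
      simp [dcoeff]
      ring
    rw [e]
    exact h
  · rw [norm_mul, norm_mul, norm_pow, RCLike.norm_ofReal, RCLike.norm_natCast]
    have : ‖v‖ ≤ y := by simpa using (Metric.mem_ball.1 hv).le
    gcongr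

theorem deriv_psum {a : ℕ → ℝ} {z : 𝕜} (hz : ENNReal.ofReal ‖z‖ < radius a) :
    deriv (psum a : 𝕜 → 𝕜) z = psum (dcoeff a) z := (hasDerivAt_psum hz).deriv

theorem eventually_norm_lt_radius {r : ℝ≥0∞} {z : 𝕜} (hz : ENNReal.ofReal ‖z‖ < r) :
    ∀ᶠ v in 𝓝 z, ENNReal.ofReal ‖v‖ < r := by
  have : Continuous fun v : 𝕜 => ENNReal.ofReal ‖v‖ :=
    ENNReal.continuous_ofReal.comp continuous_norm
  exact (this.tendsto z).eventually_lt_const hz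

theorem analyticAt_psum {a : ℕ → ℝ} {z : ℂ} (hz : ENNReal.ofReal ‖z‖ < radius a) :
    AnalyticAt ℂ (psum a) z := by
  rw [Complex.analyticAt_iff_eventually_differentiableAt]
  filter_upwards [eventually_norm_lt_radius hz] with v hv
  exact (hasDerivAt_psum hv).differentiableAt

theorem deriv_deriv_psum {a : ℕ → ℝ} {z : 𝕜} (hz : ENNReal.ofReal ‖z‖ < radius a) :
    deriv (deriv (psum a : 𝕜 → 𝕜)) z = psum (dcoeff (dcoeff a)) z := by
  have : deriv (psum a : 𝕜 → 𝕜) =ᶠ[𝓝 z] psum (dcoeff a) := by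
    filter_upwards [eventually_norm_lt_radius hz] with v hv
    exact deriv_psum hv
  rw [this.deriv_eq, deriv_psum (hz.trans_le (radius_le_radius_dcoeff a))]

theorem generator_nonneg {a : ℕ → ℝ} (ha : ∀ n, 0 ≤ a n) {x : ℝ} (hx : 0 ≤ x) :
    0 ≤ generator a x :=
  tsum_nonneg fun n => mul_nonneg (ha n) (pow_nonneg hx n)

theorem norm_psum_le {a : ℕ → ℝ} (ha : ∀ n, 0 ≤ a n) {z : 𝕜}
    (h : Summable fun n => a n * ‖z‖ ^ n) : ‖psum a z‖ ≤ generator a ‖z‖ := by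
  refine tsum_of_norm_bounded h.hasSum fun n => ?_
  rw [norm_coeff_mul_pow, abs_of_nonneg (ha n)]

theorem summable_mono {a : ℕ → ℝ} (ha : ∀ n, 0 ≤ a n) {x y : ℝ} (hx : 0 ≤ x) (hxy : x ≤ y)
    (h : Summable fun n => a n * y ^ n) : Summable fun n => a n * x ^ n :=
  h.of_nonneg_of_le (fun n => mul_nonneg (ha n) (pow_nonneg hx n))
    fun n => mul_le_mul_of_nonneg_left (pow_le_pow_left₀ hx hxy n) (ha n)

theorem generator_mono {a : ℕ → ℝ} (ha : ∀ n, 0 ≤ a n) {x y : ℝ} (hx : 0 ≤ x) (hxy : x ≤ y)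
    (h : Summable fun n => a n * y ^ n) : generator a x ≤ generator a y :=
  (summable_mono ha hx hxy h).tsum_le_tsum
    (fun n => mul_le_mul_of_nonneg_left (pow_le_pow_left₀ hx hxy n) (ha n)) h

theorem generator_strictMono {a : ℕ → ℝ} (ha : ∀ n, 0 ≤ a n) {i : ℕ} (hi : i ≠ 0) (hai : 0 < a i)
    {x y : ℝ} (hx : 0 ≤ x) (hxy : x < y) (h : Summable fun n => a n * y ^ n) :
    generator a x < generator a y :=
  (summable_mono ha hx hxy.le h).tsum_lt_tsum (i := i)
    (fun n => mul_le_mul_of_nonneg_left (pow_le_pow_left₀ hx hxy.le n) (ha n))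
    (mul_lt_mul_of_pos_left (pow_lt_pow_left₀ hxy hx hi) hai) h

theorem term_le_generator {a : ℕ → ℝ} (ha : ∀ n, 0 ≤ a n) {x : ℝ} (hx : 0 ≤ x)
    (h : Summable fun n => a n * x ^ n) (i : ℕ) : a i * x ^ i ≤ generator a x :=
  h.le_tsum i fun n _ => mul_nonneg (ha n) (pow_nonneg hx n)

theorem hasDerivAt_generator {a : ℕ → ℝ} {x : ℝ} (hx : 0 ≤ x)
    (h : ENNReal.ofReal x < radius a) :
    HasDerivAt (generator a) (generator (dcoeff a) x) x := by
  rw [generator_eq_psum, generator_eq_psum]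
  exact hasDerivAt_psum (by rwa [Real.norm_of_nonneg hx])

end

/-! ### Location of the singularity -/

/-- The standing hypotheses on a weight sequence. -/
structure IsSteep (w : ℕ → ℝ) : Prop where
  nonneg : ∀ i, 0 ≤ w i
  zero_pos : 0 < w 0
  radius_pos : 0 < radius w
  tendsto : Tendsto (deriv (generator w)) (upTo (radius w)) atTop

theorem IsSteep.exists_lt_deriv {w : ℕ → ℝ} (hw : IsSteep w) (M : ℝ) :
    ∃ B, 0 < B ∧ ENNReal.ofReal B < radius w ∧ M < generator (dcoeff w) B := by
  have key : ∃ B, 0 < B ∧ ENNReal.ofReal B < radius w ∧ M < deriv (generator w) B := by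
    have h := hw.tendsto.eventually_gt_atTop M
    unfold upTo at h
    split_ifs at h with hR
    · obtain ⟨B, h1, h2⟩ := (h.and (eventually_gt_atTop 0)).exists
      exact ⟨B, h2, by simp [hR], h1⟩
    · have hpos : 0 < (radius w).toReal := ENNReal.toReal_pos hw.radius_pos.ne' hR
      obtain ⟨B, h1, h2⟩ := (h.and (Ioo_mem_nhdsLT hpos)).exists
      exact ⟨B, h2.1, (ENNReal.ofReal_lt_iff_lt_toReal h2.1.le hR).2 h2.2, h1⟩
  obtain ⟨B, h1, h2, h3⟩ := key
  exact ⟨B, h1, h2, by rwa [(hasDerivAt_generator h1.le h2).deriv] at h3⟩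

theorem IsSteep.exists_two_le {w : ℕ → ℝ} (hw : IsSteep w) : ∃ i, 2 ≤ i ∧ 0 < w i := by
  by_contra! h
  obtain ⟨B, -, -, h3⟩ := hw.exists_lt_deriv (w 1)
  have hz : ∀ n, n ≠ 0 → dcoeff w n * B ^ n = 0 := by
    intro n hn
    have : w (n + 1) = 0 := le_antisymm (h _ (by lia)) (hw.nonneg _)
    simp [dcoeff, this]
  rw [generator, tsum_eq_single 0 hz] at h3
  simp [dcoeff] at h3

theorem IsSteep.dcoeff_strictMono {w : ℕ → ℝ} (hw : IsSteep w) {x y : ℝ} (hx : 0 ≤ x)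
    (hxy : x < y) (hy : ENNReal.ofReal y < radius w) :
    generator (dcoeff w) x < generator (dcoeff w) y := by
  obtain ⟨i, hi, hwi⟩ := hw.exists_two_le
  obtain ⟨i, rfl⟩ := Nat.exists_eq_add_of_le' hi
  exact generator_strictMono (dcoeff_nonneg hw.nonneg) (i := i + 1) (by simp)
    (mul_pos (by positivity) hwi) hx hxy
    (summable_of_nonneg_of_lt_radius (dcoeff_nonneg hw.nonneg) (hx.trans hxy.le)
      (hy.trans_le (radius_le_radius_dcoeff w)))

theorem IsSteep.dcoeff_mono {w : ℕ → ℝ} (hw : IsSteep w) {x y : ℝ} (hx : 0 ≤ x)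
    (hxy : x ≤ y) (hy : ENNReal.ofReal y < radius w) :
    generator (dcoeff w) x ≤ generator (dcoeff w) y := by
  rcases hxy.eq_or_lt with rfl | h
  · exact le_rfl
  · exact (hw.dcoeff_strictMono hx h hy).le

/-- The coefficients `a`, `b = a + g` of power series `F`, `U = F + G`, such that `F(x)` is the
least solution of `F(x) = x Φ(F(x) + G(x))`. -/
structure IsLeastFixed (w g a b : ℕ → ℝ) : Prop where
  a_nonneg : ∀ n, 0 ≤ a n
  g_nonneg : ∀ n, 0 ≤ g n
  g_zero : g 0 = 0
  b_eq : ∀ n, b n = a n + g n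
  b_le : ∃ C, ∀ n, b n ≤ C * a n
  b_one_pos : 0 < b 1
  fixed : ∀ x : ℝ, 0 ≤ x → Summable (fun n => b n * x ^ n) →
    Summable (fun i => w i * generator b x ^ i) ∧
      generator a x = x * generator w (generator b x)
  least : ∀ x y : ℝ, 0 ≤ x → 0 ≤ y → Summable (fun n => g n * x ^ n) →
    Summable (fun i => w i * (y + generator g x) ^ i) →
    x * generator w (y + generator g x) ≤ y →
    Summable (fun n => a n * x ^ n) ∧ generator a x ≤ y

theorem eventually_lt_of_hasDerivAt_pos {f : ℝ → ℝ} {c x : ℝ} (h : HasDerivAt f c x)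
    (hc : 0 < c) : ∀ᶠ t in 𝓝[<] x, f t < f x := by
  have hs := (hasDerivAt_iff_tendsto_slope.1 h).eventually_const_lt hc
  filter_upwards [nhdsWithin_mono x (fun t (ht : t < x) => ht.ne) hs, self_mem_nhdsWithin]
    with t h1 h2
  have h2' : t - x < 0 := sub_neg.2 h2
  rw [slope_def_field, div_pos_iff] at h1
  rcases h1 with h1 | h1 <;> linarith

theorem eventually_lt_of_hasDerivAt_neg {f : ℝ → ℝ} {c x : ℝ} (h : HasDerivAt f c x)
    (hc : c < 0) : ∀ᶠ t in 𝓝[>] x, f t < f x := by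
  have hs := (hasDerivAt_iff_tendsto_slope.1 h).eventually_lt_const hc
  filter_upwards [nhdsWithin_mono x (fun t (ht : x < t) => ht.ne') hs, self_mem_nhdsWithin]
    with t h1 h2
  have h2' : 0 < t - x := sub_pos.2 h2
  rw [slope_def_field, div_neg_iff] at h1
  rcases h1 with h1 | h1 <;> linarith

namespace IsLeastFixed

variable {w g a b : ℕ → ℝ}

theorem b_nonneg (h : IsLeastFixed w g a b) (n : ℕ) : 0 ≤ b n := by
  rw [h.b_eq]
  exact add_nonneg (h.a_nonneg n) (h.g_nonneg n)

theorem radius_eq (h : IsLeastFixed w g a b) : radius b = radius a := by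
  obtain ⟨C, hC⟩ := h.b_le
  refine le_antisymm (radius_anti (C := 1) fun n => ?_) (radius_anti (C := C) fun n => ?_)
  · rw [abs_of_nonneg (h.a_nonneg n), abs_of_nonneg (h.b_nonneg n), h.b_eq, one_mul]
    exact le_add_of_nonneg_right (h.g_nonneg n)
  · rw [abs_of_nonneg (h.a_nonneg n), abs_of_nonneg (h.b_nonneg n)]
    exact hC n

theorem summable_a (h : IsLeastFixed w g a b) {x : ℝ} (hx : 0 ≤ x)
    (hb : Summable fun n => b n * x ^ n) : Summable fun n => a n * x ^ n :=
  hb.of_nonneg_of_le (fun n => mul_nonneg (h.a_nonneg n) (pow_nonneg hx n)) fun n =>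
    mul_le_mul_of_nonneg_right (by rw [h.b_eq]; exact le_add_of_nonneg_right (h.g_nonneg n))
      (pow_nonneg hx n)

theorem summable_g (h : IsLeastFixed w g a b) {x : ℝ} (hx : 0 ≤ x)
    (hb : Summable fun n => b n * x ^ n) : Summable fun n => g n * x ^ n :=
  hb.of_nonneg_of_le (fun n => mul_nonneg (h.g_nonneg n) (pow_nonneg hx n)) fun n =>
    mul_le_mul_of_nonneg_right (by rw [h.b_eq]; exact le_add_of_nonneg_left (h.a_nonneg n))
      (pow_nonneg hx n)

theorem generator_eq (h : IsLeastFixed w g a b) {x : ℝ} (hx : 0 ≤ x)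
    (hb : Summable fun n => b n * x ^ n) : generator b x = generator a x + generator g x := by
  rw [generator, generator, generator,
    ← (h.summable_a hx hb).tsum_add (h.summable_g hx hb)]
  exact tsum_congr fun n => by rw [h.b_eq, add_mul]

theorem slope_le_one (h : IsLeastFixed w g a b) (hw : IsSteep w) {x : ℝ} (hx : 0 < x)
    (hb : Summable fun n => b n * x ^ n) (hU : ENNReal.ofReal (generator b x) < radius w) :
    x * generator (dcoeff w) (generator b x) ≤ 1 := by
  by_contra! hlt
  obtain ⟨hs, hfix⟩ := h.fixed x hx.le hb
  have hU0 : 0 ≤ generator b x := generator_nonneg h.b_nonneg hx.le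
  have hG0 : 0 ≤ generator g x := generator_nonneg h.g_nonneg hx.le
  have hUe := h.generator_eq hx.le hb
  have hF0 : 0 < generator a x := by
    rw [hfix]
    have := term_le_generator hw.nonneg hU0 hs 0
    simp only [pow_zero, mul_one] at this
    exact mul_pos hx (hw.zero_pos.trans_le this)
  have hder : HasDerivAt (fun t => x * generator w (t + generator g x) - t)
      (x * generator (dcoeff w) (generator b x) - 1) (generator a x) := by
    have h1 := hasDerivAt_generator hU0 hU
    rw [hUe] at h1
    have h2 := (h1.comp_add_const (generator a x) (generator g x)).const_mul x
    rw [← hUe] at h2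
    exact h2.sub (hasDerivAt_id _)
  have hev := eventually_lt_of_hasDerivAt_pos hder (by linarith)
  obtain ⟨t, ht, ht1⟩ := (hev.and (Ioo_mem_nhdsLT hF0)).exists
  rw [← hUe, ← hfix, sub_self] at ht
  have hst : Summable fun i => w i * (t + generator g x) ^ i :=
    summable_mono hw.nonneg (add_nonneg ht1.1.le hG0) (by rw [hUe]; linarith [ht1.2]) hs
  have := (h.least x t hx.le ht1.1.le (h.summable_g hx.le hb) hst (by linarith)).2
  linarith [ht1.2]

theorem generator_lt_radius (h : IsLeastFixed w g a b) (hw : IsSteep w) {x : ℝ} (hx : 0 ≤ x)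
    (hxr : ENNReal.ofReal x < radius b) : ENNReal.ofReal (generator b x) < radius w := by
  obtain ⟨y, hxy, hy, hyr⟩ := exists_lt_of_ofReal_lt hxr
  have hb := summable_of_nonneg_of_lt_radius h.b_nonneg hy.le hyr
  have hUy := generator_nonneg h.b_nonneg hy.le
  have h1 := le_radius_of_summable hw.nonneg hUy (h.fixed y hy.le hb).1
  have h2 := generator_strictMono h.b_nonneg one_ne_zero h.b_one_pos hx hxy hb
  have h3 := generator_nonneg h.b_nonneg hx
  exact ((ENNReal.ofReal_lt_ofReal_iff (h3.trans_lt h2)).2 h2).trans_le h1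

theorem radius_lt_top (h : IsLeastFixed w g a b) (hw : IsSteep w) : radius b < ⊤ := by
  rw [lt_top_iff_ne_top]
  intro htop
  obtain ⟨B, hB, hBr, hB1⟩ := hw.exists_lt_deriv 1
  set x := max 1 (B / b 1) with hxdef
  have hx : 0 < x := lt_max_of_lt_left one_pos
  have hxr : ENNReal.ofReal x < radius b := by simp [htop]
  have hb := summable_of_nonneg_of_lt_radius h.b_nonneg hx.le hxr
  have hUr := h.generator_lt_radius hw hx.le hxr
  have h1 := h.slope_le_one hw hx hb hUr
  have h2 := term_le_generator h.b_nonneg hx.le hb 1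
  have h3 : B ≤ generator b x := by
    refine le_trans ?_ h2
    rw [pow_one, mul_comm, ← div_le_iff₀ h.b_one_pos]
    exact le_max_right _ _
  have h4 := hw.dcoeff_mono hB.le h3 hUr
  have h5 : 1 ≤ x := le_max_left _ _
  nlinarith

theorem summable_at_radius (h : IsLeastFixed w g a b) (hw : IsSteep w) (hr : 0 < radius b) :
    Summable (fun n => b n * (radius b).toReal ^ n) ∧
      ENNReal.ofReal (generator b (radius b).toReal) < radius w := by
  set ρ := (radius b).toReal with hρdef
  have htop := (h.radius_lt_top hw).ne
  have hρ : 0 < ρ := ENNReal.toReal_pos hr.ne' htop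
  obtain ⟨B, hB, hBr, hB1⟩ := hw.exists_lt_deriv (2 / ρ)
  have hbound : ∀ᶠ x in 𝓝[<] ρ, 0 < x ∧ Summable (fun n => b n * x ^ n) ∧ generator b x < B := by
    filter_upwards [Ioo_mem_nhdsLT (half_lt_self hρ)] with x hx
    have hx0 : 0 < x := (half_pos hρ).trans hx.1
    have hxr : ENNReal.ofReal x < radius b := (ENNReal.ofReal_lt_iff_lt_toReal hx0.le htop).2 hx.2
    have hb := summable_of_nonneg_of_lt_radius h.b_nonneg hx0.le hxr
    refine ⟨hx0, hb, ?_⟩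
    by_contra! hle
    have hUr := h.generator_lt_radius hw hx0.le hxr
    have h1 := h.slope_le_one hw hx0 hb hUr
    have h2 := hw.dcoeff_mono hB.le hle hUr
    have h3 : 2 / ρ * x < 1 := by
      nlinarith
    rw [div_mul_eq_mul_div, div_lt_one hρ] at h3
    linarith [hx.1]
  have hpart : ∀ s : Finset ℕ, ∑ n ∈ s, b n * ρ ^ n ≤ B := by
    intro s
    have hc : Tendsto (fun x : ℝ => ∑ n ∈ s, b n * x ^ n) (𝓝[<] ρ)
        (𝓝 (∑ n ∈ s, b n * ρ ^ n)) := by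
      have : Continuous fun x : ℝ => ∑ n ∈ s, b n * x ^ n := by fun_prop
      exact (this.tendsto ρ).mono_left nhdsWithin_le_nhds
    refine le_of_tendsto hc ?_
    filter_upwards [hbound] with x hx
    exact (hx.2.1.sum_le_tsum s fun n _ => mul_nonneg (h.b_nonneg n)
      (pow_nonneg hx.1.le n)).trans hx.2.2.le
  have hnn : ∀ n, 0 ≤ b n * ρ ^ n := fun n => mul_nonneg (h.b_nonneg n) (pow_nonneg hρ.le n)
  refine ⟨summable_of_sum_le hnn hpart, lt_of_le_of_lt (ENNReal.ofReal_le_ofReal ?_) hBr⟩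
  exact Real.tsum_le_of_sum_le hnn hpart

theorem continuousAt_generator {a : ℕ → ℝ} {x : ℝ} (hx : 0 ≤ x)
    (h : ENNReal.ofReal x < radius a) : ContinuousAt (generator a) x :=
  (hasDerivAt_generator hx h).continuousAt

theorem exists_gt_summable (h : IsLeastFixed w g a b) (hw : IsSteep w) {x y : ℝ} (hx : 0 ≤ x)
    (hy : 0 < y) (hxg : ENNReal.ofReal x < radius g)
    (hyr : ENNReal.ofReal (y + generator g x) < radius w)
    (hlt : x * generator w (y + generator g x) < y) :
    ∃ x', x < x' ∧ ENNReal.ofReal x' ≤ radius b := by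
  have hG0 : 0 ≤ generator g x := generator_nonneg h.g_nonneg hx
  have hgc : ContinuousAt (generator g) x := continuousAt_generator hx hxg
  have hwc : ContinuousAt (generator w) (y + generator g x) :=
    continuousAt_generator (by positivity) hyr
  have hyg : ContinuousAt (fun t => y + generator g t) x := continuousAt_const.add hgc
  have hcomp : ContinuousAt (fun t => generator w (y + generator g t)) x :=
    ContinuousAt.comp' (f := fun t => y + generator g t) hwc hyg
  have e1 : ∀ᶠ t in 𝓝 x, t * generator w (y + generator g t) < y :=
    (continuousAt_id.mul hcomp).tendsto.eventually_lt_const hlt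
  have e2 : ∀ᶠ t in 𝓝 x, ENNReal.ofReal (y + generator g t) < radius w :=
    (ENNReal.continuous_ofReal.continuousAt.comp' hyg).tendsto.eventually_lt_const hyr
  have e3 : ∀ᶠ t in 𝓝 x, ENNReal.ofReal t < radius g :=
    ENNReal.continuous_ofReal.continuousAt.tendsto.eventually_lt_const hxg
  obtain ⟨t, ⟨e1, e2, e3⟩, hxt⟩ :=
    (((e1.and (e2.and e3)).filter_mono (nhdsWithin_le_nhds (s := Set.Ioi x))).and
      self_mem_nhdsWithin).exists
  have ht : 0 ≤ t := hx.trans (le_of_lt hxt)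
  have hGt : 0 ≤ generator g t := generator_nonneg h.g_nonneg ht
  have hs := (h.least t y ht hy.le (summable_of_nonneg_of_lt_radius h.g_nonneg ht e3)
    (summable_of_nonneg_of_lt_radius hw.nonneg (by positivity) e2) e1.le).1
  exact ⟨t, hxt, by rw [h.radius_eq]; exact le_radius_of_summable h.a_nonneg ht hs⟩

theorem radius_pos (h : IsLeastFixed w g a b) (hw : IsSteep w) (hg : 0 < radius g) :
    0 < radius b := by
  obtain ⟨B, -, hB, hBr⟩ := exists_lt_of_ofReal_lt (x := 0) (by simpa using hw.radius_pos)
  have hg0 : generator g 0 = 0 := by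
    rw [generator, tsum_eq_single 0 (fun n hn => by simp [hn])]
    simp [h.g_zero]
  obtain ⟨x, hx, hxr⟩ := h.exists_gt_summable hw (x := 0) (y := B) le_rfl hB (by simpa using hg)
    (by simpa [hg0] using hBr) (by simpa using hB)
  exact (ENNReal.ofReal_pos.2 hx).trans_le hxr

theorem slope_eq_one (h : IsLeastFixed w g a b) (hw : IsSteep w) (hr : 0 < radius b)
    (hbg : radius b < radius g) :
    (radius b).toReal * generator (dcoeff w) (generator b (radius b).toReal) = 1 := by
  obtain ⟨hb, hU⟩ := h.summable_at_radius hw hr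
  have htop := (h.radius_lt_top hw).ne
  have hρ : 0 < (radius b).toReal := ENNReal.toReal_pos hr.ne' htop
  have hρr : ENNReal.ofReal (radius b).toReal = radius b := ENNReal.ofReal_toReal htop
  set ρ := (radius b).toReal with hρdef
  refine le_antisymm (h.slope_le_one hw hρ hb hU) ?_
  by_contra! hlt
  have hfix := (h.fixed ρ hρ.le hb).2
  have hU0 : 0 ≤ generator b ρ := generator_nonneg h.b_nonneg hρ.le
  have hF0 : 0 ≤ generator a ρ := generator_nonneg h.a_nonneg hρ.le
  have hUe := h.generator_eq hρ.le hb
  have hder : HasDerivAt (fun t => ρ * generator w (t + generator g ρ) - t)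
      (ρ * generator (dcoeff w) (generator b ρ) - 1) (generator a ρ) := by
    have h1 := hasDerivAt_generator hU0 hU
    rw [hUe] at h1
    have h2 := (h1.comp_add_const (generator a ρ) (generator g ρ)).const_mul ρ
    rw [← hUe] at h2
    exact h2.sub (hasDerivAt_id _)
  have e1 := eventually_lt_of_hasDerivAt_neg hder (by linarith)
  have e2 : ∀ᶠ t in 𝓝[>] generator a ρ, ENNReal.ofReal (t + generator g ρ) < radius w := by
    have : Continuous fun t : ℝ => ENNReal.ofReal (t + generator g ρ) :=
      ENNReal.continuous_ofReal.comp (continuous_add_const _)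
    exact ((this.tendsto _).mono_left nhdsWithin_le_nhds).eventually_lt_const (by rwa [← hUe])
  obtain ⟨t, ⟨e1, e2⟩, ht⟩ := ((e1.and e2).and self_mem_nhdsWithin).exists
  rw [← hUe, ← hfix, sub_self] at e1
  obtain ⟨x, hx, hxr⟩ := h.exists_gt_summable hw hρ.le (hF0.trans_lt ht) (by rwa [hρr]) e2
    (by linarith)
  rw [← hρr, ENNReal.ofReal_le_ofReal_iff hρ.le] at hxr
  linarith

end IsLeastFixed

section

/-! ### Decomposition of a tree at its root -/

theorem lt_ncard_iff_mem {s : Set ℕ} (hs : s.Finite) (h : ∀ i j, i < j → j ∈ s → i ∈ s) (i : ℕ) :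
    i < s.ncard ↔ i ∈ s := by
  classical
  have hex : ∃ n, n ∉ s := hs.exists_notMem
  have hs' : s = Set.Iio (Nat.find hex) := by
    ext j
    simp only [Set.mem_Iio, Nat.lt_find_iff, not_not]
    exact ⟨fun hj m hm => hm.lt_or_eq.elim (fun hlt => h m j hlt hj) (fun he => he ▸ hj),
      fun hj => hj j le_rfl⟩
  have hc : s.ncard = Nat.find hex := by
    conv_lhs => rw [hs']
    rw [← Nat.card_coe_set_eq]
    simp
  rw [hc]
  conv_rhs => rw [hs']
  rfl

theorem OrderedTree.ext {T T' : OrderedTree} (h : T.nodes = T'.nodes) : T = T' := by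
  cases T
  cases T'
  simpa using h

theorem OrderedTree.finite_children (T : OrderedTree) (v : List ℕ) :
    {i : ℕ | v ++ [i] ∈ T.nodes}.Finite :=
  T.nodes.finite_toSet.preimage (f := fun i => v ++ [i])
    (fun i _ j _ hij => by simpa using hij)

theorem OrderedTree.lt_outDegree_iff (T : OrderedTree) (v : List ℕ) (i : ℕ) :
    i < T.outDegree v ↔ v ++ [i] ∈ T.nodes :=
  lt_ncard_iff_mem (T.finite_children v) (fun i j hij hj => T.sibling_mem v i j hij hj) i

theorem OrderedTree.outDegree_eq_iff (T : OrderedTree) (v : List ℕ) (d : ℕ) :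
    T.outDegree v = d ↔ ∀ i, v ++ [i] ∈ T.nodes ↔ i < d := by
  simp_rw [← T.lt_outDegree_iff v]
  refine ⟨fun h i => by rw [h], fun h => ?_⟩
  exact le_antisymm (not_lt.1 fun hlt => lt_irrefl _ ((h _).1 hlt))
    (not_lt.1 fun hlt => lt_irrefl _ ((h _).2 hlt))

/-- The tree whose root has the subtrees `Ts 0, …, Ts (d - 1)`. -/
def joinTrees {d : ℕ} (Ts : Fin d → OrderedTree) : OrderedTree where
  nodes := insert [] (Finset.univ.biUnion fun i : Fin d =>
    (Ts i).nodes.image (List.cons (i : ℕ)))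
  root_mem := Finset.mem_insert_self _ _
  parent_mem := by
    intro v j h
    cases v with
    | nil => simp
    | cons a v =>
      simp only [List.cons_append, Finset.mem_insert, reduceCtorEq, Finset.mem_biUnion,
        Finset.mem_univ, Finset.mem_image, List.cons.injEq, true_and, false_or] at h ⊢
      obtain ⟨i, u, hu, rfl, rfl⟩ := h
      exact ⟨i, v, (Ts i).parent_mem v j hu, rfl, rfl⟩
  sibling_mem := by
    intro v j k hjk h
    cases v with
    | nil =>
      simp only [List.nil_append, Finset.mem_insert, List.cons_ne_nil, Finset.mem_biUnion,
        Finset.mem_univ, Finset.mem_image, List.cons.injEq, true_and, false_or] at h ⊢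
      obtain ⟨i, u, hu, rfl, rfl⟩ := h
      exact ⟨⟨j, hjk.trans i.2⟩, [], OrderedTree.root_mem _, rfl, rfl⟩
    | cons a v =>
      simp only [List.cons_append, Finset.mem_insert, reduceCtorEq, Finset.mem_biUnion,
        Finset.mem_univ, Finset.mem_image, List.cons.injEq, true_and, false_or] at h ⊢
      obtain ⟨i, u, hu, rfl, rfl⟩ := h
      exact ⟨i, v ++ [j], (Ts i).sibling_mem v j k hjk hu, rfl, rfl⟩

variable {d : ℕ} (Ts : Fin d → OrderedTree)

theorem cons_mem_joinTrees (a : ℕ) (v : List ℕ) :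
    a :: v ∈ (joinTrees Ts).nodes ↔ ∃ h : a < d, v ∈ (Ts ⟨a, h⟩).nodes := by
  simp only [joinTrees, Finset.mem_insert, reduceCtorEq, Finset.mem_biUnion, Finset.mem_univ,
    Finset.mem_image, List.cons.injEq, true_and, false_or]
  constructor
  · rintro ⟨i, u, hu, rfl, rfl⟩
    exact ⟨i.2, hu⟩
  · rintro ⟨h, hv⟩
    exact ⟨⟨a, h⟩, v, hv, rfl, rfl⟩

theorem fin_cons_mem_joinTrees (i : Fin d) (v : List ℕ) :
    (i : ℕ) :: v ∈ (joinTrees Ts).nodes ↔ v ∈ (Ts i).nodes := by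
  rw [cons_mem_joinTrees]
  exact ⟨fun ⟨_, h⟩ => h, fun h => ⟨i.2, h⟩⟩

theorem outDegree_joinTrees_nil : (joinTrees Ts).outDegree [] = d := by
  rw [OrderedTree.outDegree_eq_iff]
  intro i
  rw [List.nil_append, cons_mem_joinTrees]
  exact ⟨fun ⟨h, _⟩ => h, fun h => ⟨h, OrderedTree.root_mem _⟩⟩

theorem outDegree_joinTrees_cons (i : Fin d) (v : List ℕ) :
    (joinTrees Ts).outDegree ((i : ℕ) :: v) = (Ts i).outDegree v := by
  rw [OrderedTree.outDegree, OrderedTree.outDegree]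
  simp only [List.cons_append, fin_cons_mem_joinTrees]

@[to_additive]
theorem prod_joinTrees {M : Type*} [CommMonoid M] (f : List ℕ → M) :
    ∏ v ∈ (joinTrees Ts).nodes, f v = f [] * ∏ i : Fin d, ∏ v ∈ (Ts i).nodes, f ((i : ℕ) :: v) := by
  rw [joinTrees, Finset.prod_insert (by simp), Finset.prod_biUnion]
  · congr 1
    refine Finset.prod_congr rfl fun i _ => ?_
    rw [Finset.prod_image]
    intro u _ v _ h
    simpa using h
  · intro i _ j _ hij
    rw [Function.onFun, Finset.disjoint_left]
    intro u hu hv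
    obtain ⟨u', _, rfl⟩ := Finset.mem_image.1 hu
    obtain ⟨v', _, h⟩ := Finset.mem_image.1 hv
    exact hij (Fin.ext (List.cons.inj h).1.symm)

theorem size_joinTrees : (joinTrees Ts).size = 1 + ∑ i, (Ts i).size := by
  simp only [OrderedTree.size, Finset.card_eq_sum_ones, sum_joinTrees]

theorem weight_joinTrees (w : ℕ → ℝ) :
    (joinTrees Ts).weight w = w d * ∏ i, (Ts i).weight w := by
  simp only [OrderedTree.weight, prod_joinTrees, outDegree_joinTrees_nil, outDegree_joinTrees_cons]

theorem joinTrees_bijective :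
    Function.Bijective fun p : (Σ d, Fin d → OrderedTree) => joinTrees p.2 := by
  constructor
  · rintro ⟨d, Ts⟩ ⟨d', Ts'⟩ h
    simp only at h
    obtain rfl : d = d' := by
      rw [← outDegree_joinTrees_nil Ts, h, outDegree_joinTrees_nil]
    congr 1
    ext i : 1
    apply OrderedTree.ext
    ext v
    rw [← fin_cons_mem_joinTrees, h, fin_cons_mem_joinTrees]
  · intro T
    have hmem : ∀ i : Fin (T.outDegree []), [(i : ℕ)] ∈ T.nodes := fun i => by
      simpa using (T.lt_outDegree_iff [] i).1 i.2
    refine ⟨⟨T.outDegree [], fun i =>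
      { nodes := T.nodes.preimage (List.cons (i : ℕ)) List.cons_injective.injOn
        root_mem := by simpa using hmem i
        parent_mem := fun v j h => by
          rw [Finset.mem_preimage] at h ⊢
          exact T.parent_mem (i :: v) j h
        sibling_mem := fun v j k hjk h => by
          rw [Finset.mem_preimage] at h ⊢
          exact T.sibling_mem (i :: v) j k hjk h }⟩, ?_⟩
    apply OrderedTree.ext
    ext v
    cases v with
    | nil => simp [OrderedTree.root_mem]
    | cons a v =>
      simp only [cons_mem_joinTrees, Finset.mem_preimage, exists_prop, and_iff_right_iff_imp]
      intro h
      rw [T.lt_outDegree_iff]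
      exact T.prefix_mem _ v h

/-- The sets of nodes, possibly empty, that are closed under taking parents. -/
def closedSubsets (S : Set (List ℕ)) : Set (Set (List ℕ)) :=
  {V | V ⊆ S ∧ ∀ v i, v ++ [i] ∈ V → v ∈ V}

theorem nil_mem_of_closed {V : Set (List ℕ)} (hV : ∀ v i, v ++ [i] ∈ V → v ∈ V)
    (h : V.Nonempty) : [] ∈ V := by
  obtain ⟨v, hv⟩ := h
  induction v using List.reverseRecOn with
  | nil => exact hv
  | append_singleton v i ih => exact ih (hV v i hv)

theorem ncard_closedSubsets {S : Set (List ℕ)} (hS : S.Finite) :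
    (closedSubsets S).ncard = numRootSubtrees S + 1 := by
  have h : closedSubsets S = insert ∅ (rootSubtrees S) := by
    ext V
    simp only [closedSubsets, rootSubtrees, Set.mem_insert_iff, Set.mem_ofPred_eq]
    rcases V.eq_empty_or_nonempty with rfl | hV
    · simp
    · simp [hV, hV.ne_empty]
  have hfin : (rootSubtrees S).Finite := hS.finite_subsets.subset fun V hV => hV.1
  rw [h, Set.ncard_insert_of_notMem (fun h => by simpa using h.2.1) hfin, numRootSubtrees]

theorem numRootSubtrees_joinTrees :
    numRootSubtrees (joinTrees Ts).nodes = ∏ i, (numRootSubtrees (Ts i).nodes + 1) := by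
  let e : rootSubtrees ((joinTrees Ts).nodes : Set (List ℕ)) ≃
      ∀ i, closedSubsets ((Ts i).nodes : Set (List ℕ)) :=
    { toFun := fun V i => ⟨{v | (i : ℕ) :: v ∈ V.1},
        fun v hv => (fin_cons_mem_joinTrees Ts i v).1 (V.2.1 hv),
        fun v j hv => V.2.2.2 (i :: v) j hv⟩
      invFun := fun W => ⟨{x | x = [] ∨ ∃ i : Fin d, ∃ v ∈ (W i).1, x = (i : ℕ) :: v}, by
        refine ⟨?_, ⟨[], Or.inl rfl⟩, ?_⟩
        · rintro x (rfl | ⟨i, v, hv, rfl⟩)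
          · exact OrderedTree.root_mem _
          · exact (fin_cons_mem_joinTrees Ts i v).2 ((W i).2.1 hv)
        · rintro x j (h | ⟨i, v, hv, h⟩)
          · simp at h
          · cases x with
            | nil => exact Or.inl rfl
            | cons a x =>
              simp only [List.cons_append, List.cons.injEq] at h
              obtain ⟨rfl, rfl⟩ := h
              exact Or.inr ⟨i, x, (W i).2.2 x j hv, rfl⟩⟩
      left_inv := fun V => by
        ext x
        simp only [Set.mem_ofPred_eq]
        cases x with
        | nil => simpa using nil_mem_of_closed V.2.2.2 V.2.2.1
        | cons a x =>
          constructor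
          · rintro (h | ⟨i, v, hv, h⟩)
            · simp at h
            · rwa [h]
          · intro h
            obtain ⟨ha, -⟩ := (cons_mem_joinTrees Ts a x).1 (V.2.1 h)
            exact Or.inr ⟨⟨a, ha⟩, x, h, rfl⟩
      right_inv := fun W => by
        ext i v
        simp only [Set.mem_ofPred_eq]
        constructor
        · rintro (h | ⟨j, u, hu, h⟩)
          · simp at h
          · simp only [List.cons.injEq] at h
            obtain ⟨h1, rfl⟩ := h
            obtain rfl := Fin.ext h1
            exact hu
        · intro h
          exact Or.inr ⟨i, v, h, rfl⟩ }
  have h1 := Nat.card_congr e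
  rw [Nat.card_pi, Nat.card_coe_set_eq] at h1
  rw [numRootSubtrees, h1]
  refine Finset.prod_congr rfl fun i _ => ?_
  rw [Nat.card_coe_set_eq, ncard_closedSubsets (Finset.finite_toSet _)]

theorem one_le_numRootSubtrees (T : OrderedTree) : 1 ≤ numRootSubtrees T.nodes := by
  obtain ⟨⟨d, Ts⟩, rfl⟩ := joinTrees_bijective.2 T
  simp only [numRootSubtrees_joinTrees]
  exact Finset.one_le_prod' fun i _ => by simp

theorem OrderedTree.weight_nonneg {w : ℕ → ℝ} (hw : ∀ i, 0 ≤ w i) (T : OrderedTree) :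
    0 ≤ T.weight w := Finset.prod_nonneg fun _ _ => hw _

theorem size_lt_size_joinTrees (i : Fin d) : (Ts i).size < (joinTrees Ts).size := by
  rw [size_joinTrees]
  have := Finset.single_le_sum (f := fun i => (Ts i).size) (fun _ _ => Nat.zero_le _)
    (Finset.mem_univ i)
  lia

theorem OrderedTree.size_pos (T : OrderedTree) : 0 < T.size :=
  Finset.card_pos.2 ⟨[], T.root_mem⟩

/-- The degrees of a tree of positive weight are multiples of `p` if `p` divides each `i` with
`w i ≠ 0`; hence so is its size minus one. -/
theorem size_mod_of_weight_ne_zero {w : ℕ → ℝ} {p : ℕ} (hp : ∀ i, w i ≠ 0 → p ∣ i)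
    (T : OrderedTree) (hT : T.weight w ≠ 0) : p ∣ T.size - 1 := by
  induction hn : T.size using Nat.strong_induction_on generalizing T with
  | _ n ih =>
    obtain ⟨⟨d, Ts⟩, rfl⟩ := joinTrees_bijective.2 T
    simp only at hT hn
    rw [weight_joinTrees] at hT
    have h1 : ∀ i, p ∣ (Ts i).size - 1 := fun i =>
      ih _ (hn ▸ size_lt_size_joinTrees Ts i) (Ts i)
        (Finset.prod_ne_zero_iff.1 (right_ne_zero_of_mul hT) i (Finset.mem_univ i)) rfl
    rw [← hn, size_joinTrees, Nat.add_sub_cancel_left]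
    have h2 : ∑ i, (Ts i).size = ∑ i, ((Ts i).size - 1) + d := by
      have : ∀ i, (Ts i).size = ((Ts i).size - 1) + 1 := fun i =>
        (Nat.sub_add_cancel (Ts i).size_pos).symm
      rw [Finset.sum_congr rfl fun i _ => this i, Finset.sum_add_distrib]
      simp
    rw [h2]
    exact dvd_add (Finset.dvd_sum fun i _ => h1 i) (hp d (left_ne_zero_of_mul hT))

end

section

/-! ### The functional equation -/

theorem tsum_fin_pi_prod {α : Type*} (f : α → ℝ≥0∞) (d : ℕ) :
    ∑' x : Fin d → α, ∏ i, f (x i) = (∑' a, f a) ^ d := by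
  induction d with
  | zero => simp
  | succ d ih =>
    rw [← (Fin.consEquiv fun _ : Fin (d + 1) => α).tsum_eq, pow_succ', ← ih,
      ← ENNReal.tsum_mul_right]
    simp_rw [← ENNReal.tsum_mul_left]
    rw [← ENNReal.tsum_prod]
    refine tsum_congr fun p => ?_
    rw [Fin.prod_univ_succ]
    simp [Fin.consEquiv]

theorem tsum_orderedTree (f : OrderedTree → ℝ≥0∞) :
    ∑' T, f T = ∑' (d : ℕ) (Ts : Fin d → OrderedTree), f (joinTrees Ts) := by
  rw [← (Equiv.ofBijective _ joinTrees_bijective).tsum_eq, ← ENNReal.tsum_sigma]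
  rfl

/-- `R(T)` as a real number. -/
def OrderedTree.numRoot (T : OrderedTree) : ℝ := numRootSubtrees T.nodes

theorem OrderedTree.one_le_numRoot (T : OrderedTree) : 1 ≤ T.numRoot := by
  rw [OrderedTree.numRoot]
  exact_mod_cast one_le_numRootSubtrees T

theorem OrderedTree.numRoot_nonneg (T : OrderedTree) : 0 ≤ T.numRoot :=
  zero_le_one.trans T.one_le_numRoot

theorem numRoot_joinTrees {d : ℕ} (Ts : Fin d → OrderedTree) :
    (joinTrees Ts).numRoot = ∏ i, ((Ts i).numRoot + 1) := by
  simp [OrderedTree.numRoot, numRootSubtrees_joinTrees]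

/-- The coefficient of `x ^ n` in `∑_T w(T) c(T) x^{|T|}`. -/
def treeCoeff (w : ℕ → ℝ) (c : OrderedTree → ℝ) (n : ℕ) : ℝ :=
  ∑' T : TreeOfSize n, T.1.weight w * c T.1

theorem coeffF_eq (w : ℕ → ℝ) (m : ℕ) : coeffF w m = treeCoeff w fun T => T.numRoot ^ m := rfl

variable {w : ℕ → ℝ}

theorem treeCoeff_nonneg (hw : ∀ i, 0 ≤ w i) {c : OrderedTree → ℝ} (hc : ∀ T, 0 ≤ c T) (n : ℕ) :
    0 ≤ treeCoeff w c n :=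
  tsum_nonneg fun T => mul_nonneg (T.1.weight_nonneg hw) (hc T.1)

theorem treeCoeff_mono (hw : ∀ i, 0 ≤ w i) {c c' : OrderedTree → ℝ} (hc : ∀ T, c T ≤ c' T)
    (n : ℕ) : treeCoeff w c n ≤ treeCoeff w c' n :=
  (Summable.of_finite).tsum_le_tsum
    (fun T => mul_le_mul_of_nonneg_left (hc T.1) (T.1.weight_nonneg hw)) Summable.of_finite

theorem treeCoeff_const_mul (C : ℝ) (c : OrderedTree → ℝ) (n : ℕ) :
    treeCoeff w (fun T => C * c T) n = C * treeCoeff w c n := by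
  rw [treeCoeff, treeCoeff, ← tsum_mul_left]
  exact tsum_congr fun T => by ring

theorem treeCoeff_add (c c' : OrderedTree → ℝ) (n : ℕ) :
    treeCoeff w (fun T => c T + c' T) n = treeCoeff w c n + treeCoeff w c' n := by
  rw [treeCoeff, treeCoeff, treeCoeff, ← (Summable.of_finite).tsum_add Summable.of_finite]
  exact tsum_congr fun T => by ring

theorem le_treeCoeff (hw : ∀ i, 0 ≤ w i) {c : OrderedTree → ℝ} (hc : ∀ T, 0 ≤ c T)
    (T : OrderedTree) : T.weight w * c T ≤ treeCoeff w c T.size :=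
  (Summable.of_finite (f := fun T' : TreeOfSize T.size => T'.1.weight w * c T'.1)).le_tsum ⟨T, rfl⟩
    fun T' _ => mul_nonneg (T'.1.weight_nonneg hw) (hc T'.1)

theorem treeCoeff_zero (c : OrderedTree → ℝ) : treeCoeff w c 0 = 0 := by
  have : IsEmpty (TreeOfSize 0) := ⟨fun T => T.1.size_pos.ne' T.2⟩
  exact tsum_empty

theorem tsum_ofReal_treeCoeff (hw : ∀ i, 0 ≤ w i) {c : OrderedTree → ℝ} (hc : ∀ T, 0 ≤ c T)
    {x : ℝ} (hx : 0 ≤ x) :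
    ∑' n, ENNReal.ofReal (treeCoeff w c n * x ^ n) =
      ∑' T : OrderedTree, ENNReal.ofReal (T.weight w * c T * x ^ T.size) := by
  rw [← (Equiv.sigmaFiberEquiv OrderedTree.size).tsum_eq]
  refine Eq.trans ?_ (ENNReal.tsum_sigma (fun n (T : TreeOfSize n) =>
    ENNReal.ofReal (T.1.weight w * c T.1 * x ^ T.1.size))).symm
  refine tsum_congr fun n => ?_
  rw [treeCoeff, ← tsum_mul_right, ENNReal.ofReal_tsum_of_nonneg]
  · exact tsum_congr fun T => by rw [T.2]
  · exact fun T => mul_nonneg (mul_nonneg (T.1.weight_nonneg hw) (hc T.1)) (pow_nonneg hx n)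
  · exact Summable.of_finite

/-- `w(T) c(T) x^{|T|}` in `[0, ∞]`. -/
def treeTerm (w : ℕ → ℝ) (x : ℝ) (c : OrderedTree → ℝ) (T : OrderedTree) : ℝ≥0∞ :=
  ENNReal.ofReal (T.weight w * c T * x ^ T.size)

theorem treeTerm_joinTrees (hw : ∀ i, 0 ≤ w i) {x : ℝ} (hx : 0 ≤ x) (m : ℕ) {d : ℕ}
    (Ts : Fin d → OrderedTree) :
    treeTerm w x (fun T => T.numRoot ^ m) (joinTrees Ts) =
      ENNReal.ofReal x * ENNReal.ofReal (w d) *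
        ∏ i, treeTerm w x (fun T => (T.numRoot + 1) ^ m) (Ts i) := by
  simp only [treeTerm]
  rw [← ENNReal.ofReal_prod_of_nonneg, ← ENNReal.ofReal_mul hx, ← ENNReal.ofReal_mul
    (mul_nonneg hx (hw d)), weight_joinTrees, numRoot_joinTrees, size_joinTrees]
  · congr 1
    rw [Finset.prod_mul_distrib, Finset.prod_mul_distrib, Finset.prod_pow_eq_pow_sum,
      Finset.prod_pow, pow_add, pow_one]
    ring
  · intro i _
    exact mul_nonneg (mul_nonneg ((Ts i).weight_nonneg hw)
      (pow_nonneg (by linarith [(Ts i).numRoot_nonneg]) m)) (pow_nonneg hx _)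

theorem tsum_treeTerm_eq (hw : ∀ i, 0 ≤ w i) {x : ℝ} (hx : 0 ≤ x) (m : ℕ) :
    ∑' T, treeTerm w x (fun T => T.numRoot ^ m) T =
      ENNReal.ofReal x * ∑' d, ENNReal.ofReal (w d) *
        (∑' T, treeTerm w x (fun T => (T.numRoot + 1) ^ m) T) ^ d := by
  rw [tsum_orderedTree, ← ENNReal.tsum_mul_left]
  refine tsum_congr fun d => ?_
  simp_rw [treeTerm_joinTrees hw hx, ENNReal.tsum_mul_left, tsum_fin_pi_prod, mul_assoc]

theorem tsum_treeTerm_le (hw : ∀ i, 0 ≤ w i) {x : ℝ} (hx : 0 ≤ x) (m : ℕ) {y : ℝ≥0∞}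
    (hy : ENNReal.ofReal x * ∑' d, ENNReal.ofReal (w d) *
      (y + ∑' T, treeTerm w x (fun T => (T.numRoot + 1) ^ m - T.numRoot ^ m) T) ^ d ≤ y) :
    ∑' T, treeTerm w x (fun T => T.numRoot ^ m) T ≤ y := by
  set φ := treeTerm w x (fun T => T.numRoot ^ m) with hφ
  set γ := treeTerm w x (fun T => (T.numRoot + 1) ^ m - T.numRoot ^ m) with hγ
  set ψ := treeTerm w x (fun T => (T.numRoot + 1) ^ m) with hψ
  have hadd : ∀ T, ψ T = φ T + γ T := by
    intro T
    have h1 := T.weight_nonneg hw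
    have h2 := T.numRoot_nonneg
    have h3 : T.numRoot ^ m ≤ (T.numRoot + 1) ^ m := pow_le_pow_left₀ h2 (by linarith) m
    rw [hψ, hφ, hγ, treeTerm, treeTerm, treeTerm, ← ENNReal.ofReal_add (by positivity)
      (mul_nonneg (mul_nonneg h1 (sub_nonneg.2 h3)) (pow_nonneg hx _))]
    congr 1
    ring
  have key : ∀ N : ℕ, ∑' T, (if T.size ≤ N then φ T else 0) ≤ y := by
    intro N
    induction N with
    | zero =>
      have : ∀ T : OrderedTree, (if T.size ≤ 0 then φ T else 0) = 0 := fun T =>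
        if_neg (by have := T.size_pos; lia)
      simp_rw [this]
      simp
    | succ N ih =>
      refine le_trans ?_ hy
      have hU : ∑' T, (if T.size ≤ N then ψ T else 0) ≤ y + ∑' T, γ T := by
        have : ∀ T : OrderedTree, (if T.size ≤ N then ψ T else 0) ≤
            (if T.size ≤ N then φ T else 0) + γ T := by
          intro T
          split_ifs
          · exact (hadd T).le
          · simp
        refine (ENNReal.tsum_le_tsum this).trans ?_
        rw [ENNReal.tsum_add]
        gcongr
      calc ∑' T, (if T.size ≤ N + 1 then φ T else 0)
          ≤ ∑' (d : ℕ) (Ts : Fin d → OrderedTree), ENNReal.ofReal x * ENNReal.ofReal (w d) *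
              ∏ i, (if (Ts i).size ≤ N then ψ (Ts i) else 0) := by
            rw [tsum_orderedTree]
            refine ENNReal.tsum_le_tsum fun d => ENNReal.tsum_le_tsum fun Ts => ?_
            split_ifs with hs
            · rw [hφ, treeTerm_joinTrees hw hx, ← hψ]
              refine le_of_eq ?_
              congr 1
              refine Finset.prod_congr rfl fun i _ => ?_
              have := size_lt_size_joinTrees Ts i
              rw [if_pos (by lia)]
            · exact bot_le
        _ = ENNReal.ofReal x * ∑' d, ENNReal.ofReal (w d) *
              (∑' T, (if T.size ≤ N then ψ T else 0)) ^ d := by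
            rw [← ENNReal.tsum_mul_left]
            refine tsum_congr fun d => ?_
            rw [ENNReal.tsum_mul_left,
              tsum_fin_pi_prod (fun T : OrderedTree => if T.size ≤ N then ψ T else 0), mul_assoc]
        _ ≤ _ := by gcongr
  rw [ENNReal.tsum_eq_iSup_sum]
  refine iSup_le fun s => ?_
  refine le_trans ?_ (key (s.sup OrderedTree.size))
  refine le_trans (le_of_eq ?_) (ENNReal.sum_le_tsum s)
  refine Finset.sum_congr rfl fun T hT => ?_
  rw [if_pos (Finset.le_sup hT)]

theorem summable_iff_tsum_ofReal {f : ℕ → ℝ} (hf : ∀ n, 0 ≤ f n) :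
    Summable f ↔ ∑' n, ENNReal.ofReal (f n) ≠ ⊤ := by
  refine ⟨fun h => ?_, fun h => ?_⟩
  · rw [← ENNReal.ofReal_tsum_of_nonneg hf h]
    exact ENNReal.ofReal_ne_top
  · refine (ENNReal.summable_toReal h).congr fun n => ?_
    exact ENNReal.toReal_ofReal (hf n)

theorem tsum_ofReal_generator {a : ℕ → ℝ} (ha : ∀ n, 0 ≤ a n) {x : ℝ} (hx : 0 ≤ x)
    (h : Summable fun n => a n * x ^ n) :
    ∑' n, ENNReal.ofReal (a n * x ^ n) = ENNReal.ofReal (generator a x) :=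
  (ENNReal.ofReal_tsum_of_nonneg (fun n => mul_nonneg (ha n) (pow_nonneg hx n)) h).symm

theorem tsum_ofReal_mul_pow (hw : ∀ i, 0 ≤ w i) {y : ℝ} (hy : 0 ≤ y) :
    ∑' d, ENNReal.ofReal (w d) * ENNReal.ofReal y ^ d = ∑' d, ENNReal.ofReal (w d * y ^ d) :=
  tsum_congr fun d => by rw [ENNReal.ofReal_mul (hw d), ENNReal.ofReal_pow hy]

theorem isLeastFixed_treeCoeff (hw : ∀ i, 0 ≤ w i) (hw0 : 0 < w 0) (m : ℕ) :
    IsLeastFixed w (treeCoeff w fun T => (T.numRoot + 1) ^ m - T.numRoot ^ m)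
      (coeffF w m) (treeCoeff w fun T => (T.numRoot + 1) ^ m) := by
  have hR : ∀ T : OrderedTree, 0 ≤ T.numRoot ^ m := fun T => pow_nonneg T.numRoot_nonneg m
  have hR1 : ∀ T : OrderedTree, 0 ≤ (T.numRoot + 1) ^ m := fun T =>
    pow_nonneg (by linarith [T.numRoot_nonneg]) m
  have hle : ∀ T : OrderedTree, T.numRoot ^ m ≤ (T.numRoot + 1) ^ m := fun T =>
    pow_le_pow_left₀ T.numRoot_nonneg (by linarith) m
  have hg : ∀ T : OrderedTree, 0 ≤ (T.numRoot + 1) ^ m - T.numRoot ^ m := fun T =>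
    sub_nonneg.2 (hle T)
  have ha0 := fun n => treeCoeff_nonneg hw hR n
  have hg0 := fun n => treeCoeff_nonneg hw hg n
  have hb0 := fun n => treeCoeff_nonneg hw hR1 n
  have hbs : ∀ x : ℝ, 0 ≤ x → _ := fun x hx => tsum_ofReal_treeCoeff hw hR1 hx
  have has : ∀ x : ℝ, 0 ≤ x → _ := fun x hx => tsum_ofReal_treeCoeff hw hR hx
  have hgs : ∀ x : ℝ, 0 ≤ x → _ := fun x hx => tsum_ofReal_treeCoeff hw hg hx
  have nn : ∀ {a : ℕ → ℝ} (_ : ∀ n, 0 ≤ a n) {x : ℝ} (_ : 0 ≤ x) (n : ℕ), 0 ≤ a n * x ^ n :=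
    fun ha _ hx n => mul_nonneg (ha n) (pow_nonneg hx n)
  rw [coeffF_eq]
  refine ⟨ha0, hg0, treeCoeff_zero _, fun n => ?_, ⟨2 ^ m, fun n => ?_⟩, ?_, fun x hx hb => ?_,
    fun x y hx hy hgx hwy hxy => ?_⟩
  · rw [← treeCoeff_add]
    simp
  · rw [← treeCoeff_const_mul]
    refine treeCoeff_mono hw (fun T => ?_) n
    rw [← mul_pow]
    exact pow_le_pow_left₀ (by linarith [T.numRoot_nonneg]) (by linarith [T.one_le_numRoot]) m
  · have h1 := le_treeCoeff hw hR1 (joinTrees (Fin.elim0 : Fin 0 → OrderedTree))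
    rw [size_joinTrees, weight_joinTrees, numRoot_joinTrees] at h1
    simp only [Finset.univ_eq_empty, Finset.prod_empty, Finset.sum_empty, mul_one, add_zero] at h1
    exact lt_of_lt_of_le (by positivity) h1
  · have hU0 := generator_nonneg hb0 hx
    have e := tsum_treeTerm_eq hw hx m
    simp only [treeTerm] at e
    rw [← has x hx, ← hbs x hx, tsum_ofReal_generator hb0 hx hb, tsum_ofReal_mul_pow hw hU0] at e
    rcases hx.eq_or_lt with rfl | hx0
    · have hz : generator (treeCoeff w fun T => (T.numRoot + 1) ^ m) 0 = 0 := by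
        rw [generator, tsum_eq_single 0 (fun n hn => by simp [hn])]
        simp [treeCoeff_zero]
      have hz' : generator (treeCoeff w fun T => T.numRoot ^ m) 0 = 0 := by
        rw [generator, tsum_eq_single 0 (fun n hn => by simp [hn])]
        simp [treeCoeff_zero]
      rw [hz, hz', zero_mul]
      refine ⟨summable_of_ne_finset_zero (s := {0}) fun n hn => ?_, rfl⟩
      simp only [Finset.mem_singleton] at hn
      simp [hn]
    · have hsa : Summable fun n => treeCoeff w (fun T => T.numRoot ^ m) n * x ^ n :=
        hb.of_nonneg_of_le (nn ha0 hx) fun n =>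
          mul_le_mul_of_nonneg_right (treeCoeff_mono hw hle n) (pow_nonneg hx n)
      rw [tsum_ofReal_generator ha0 hx hsa] at e
      have hsw : Summable fun i =>
          w i * generator (treeCoeff w fun T => (T.numRoot + 1) ^ m) x ^ i := by
        rw [summable_iff_tsum_ofReal (nn hw hU0)]
        intro htop
        rw [htop, ENNReal.mul_top (ENNReal.ofReal_pos.2 hx0).ne'] at e
        exact ENNReal.ofReal_ne_top e
      refine ⟨hsw, ?_⟩
      rw [tsum_ofReal_generator hw hU0 hsw, ← ENNReal.ofReal_mul hx] at e
      exact (ENNReal.ofReal_eq_ofReal_iff (generator_nonneg ha0 hx)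
        (mul_nonneg hx (generator_nonneg hw hU0))).1 e
  · have hG0 := generator_nonneg hg0 hx
    have e := tsum_treeTerm_le (y := ENNReal.ofReal y) hw hx m (by
      simp only [treeTerm]
      rw [← hgs x hx, tsum_ofReal_generator hg0 hx hgx, ← ENNReal.ofReal_add hy hG0,
        tsum_ofReal_mul_pow hw (add_nonneg hy hG0),
        tsum_ofReal_generator hw (add_nonneg hy hG0) hwy, ← ENNReal.ofReal_mul hx]
      exact ENNReal.ofReal_le_ofReal hxy)
    simp only [treeTerm] at e
    rw [← has x hx] at e
    have hsa : Summable fun n => treeCoeff w (fun T => T.numRoot ^ m) n * x ^ n := by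
      rw [summable_iff_tsum_ofReal (nn ha0 hx)]
      exact ne_top_of_le_ne_top ENNReal.ofReal_ne_top e
    refine ⟨hsa, ?_⟩
    rwa [tsum_ofReal_generator ha0 hx hsa, ENNReal.ofReal_le_ofReal_iff hy] at e

end

section

/-! ### The radii of convergence -/

/-- The coefficients of `F_m + G_m = ∑_T w(T) (R(T) + 1)^m z^{|T|}`. -/
def coeffU (w : ℕ → ℝ) (m : ℕ) : ℕ → ℝ := treeCoeff w fun T => (T.numRoot + 1) ^ m

/-- The coefficients of `G_m = ∑_T w(T) ((R(T) + 1)^m - R(T)^m) z^{|T|}`. -/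
def coeffG (w : ℕ → ℝ) (m : ℕ) : ℕ → ℝ :=
  treeCoeff w fun T => (T.numRoot + 1) ^ m - T.numRoot ^ m

variable {w : ℕ → ℝ}

theorem IsSteep.isLeastFixed (hw : IsSteep w) (m : ℕ) :
    IsLeastFixed w (coeffG w m) (coeffF w m) (coeffU w m) :=
  isLeastFixed_treeCoeff hw.nonneg hw.zero_pos m

theorem IsSteep.radius_coeffU (hw : IsSteep w) (m : ℕ) : radius (coeffU w m) = rho w m :=
  (hw.isLeastFixed m).radius_eq

theorem pow_succ_sub_pow_succ_le {R : ℝ} (hR : 1 ≤ R) (m : ℕ) :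
    (R + 1) ^ (m + 1) - R ^ (m + 1) ≤ 3 ^ (m + 1) * R ^ m := by
  induction m with
  | zero => norm_num
  | succ m ih =>
    have h1 : (R + 1) ^ (m + 1 + 1) - R ^ (m + 1 + 1) =
        (R + 1) * ((R + 1) ^ (m + 1) - R ^ (m + 1)) + R ^ (m + 1) := by ring
    have h2 : (R + 1) * ((R + 1) ^ (m + 1) - R ^ (m + 1)) ≤
        (2 * R) * (3 ^ (m + 1) * R ^ m) :=
      (mul_le_mul_of_nonneg_left ih (by linarith)).trans
        (mul_le_mul_of_nonneg_right (by linarith) (by positivity))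
    have h3 : R ^ (m + 1) ≤ 3 ^ (m + 1) * R ^ (m + 1) :=
      le_mul_of_one_le_left (by positivity) (one_le_pow₀ (by norm_num))
    have h4 : (3 : ℝ) ^ (m + 1 + 1) * R ^ (m + 1) =
        (2 * R) * (3 ^ (m + 1) * R ^ m) + 3 ^ (m + 1) * R ^ (m + 1) := by ring
    linarith

theorem radius_coeffG_zero (w : ℕ → ℝ) : radius (coeffG w 0) = ⊤ := by
  have h0 : coeffG w 0 = fun _ => 0 := by
    ext n
    simp [coeffG, treeCoeff]
  refine ENNReal.eq_top_of_forall_nnreal_le fun r => ?_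
  rw [← ENNReal.ofReal_coe_nnreal]
  refine le_radius_of_summable_abs r.2 ?_
  simp [h0]

theorem IsSteep.rho_le_radius_coeffG_succ (hw : IsSteep w) (m : ℕ) :
    rho w m ≤ radius (coeffG w (m + 1)) := by
  refine radius_anti (C := 3 ^ (m + 1)) fun n => ?_
  rw [abs_of_nonneg ((hw.isLeastFixed (m + 1)).g_nonneg n),
    abs_of_nonneg ((hw.isLeastFixed m).a_nonneg n), coeffF_eq, ← treeCoeff_const_mul]
  exact treeCoeff_mono hw.nonneg (fun T => pow_succ_sub_pow_succ_le T.one_le_numRoot m) n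

theorem IsSteep.two_mul_coeffU_le (hw : IsSteep w) (m n : ℕ) :
    2 * coeffU w m n ≤ coeffU w (m + 1) n := by
  rw [coeffU, ← treeCoeff_const_mul]
  refine treeCoeff_mono hw.nonneg (fun T => ?_) n
  rw [pow_succ']
  exact mul_le_mul_of_nonneg_right (by linarith [T.one_le_numRoot])
    (pow_nonneg (by linarith [T.one_le_numRoot]) m)

theorem IsSteep.rho_lt_top (hw : IsSteep w) (m : ℕ) : rho w m < ⊤ := by
  rw [← hw.radius_coeffU]
  exact (hw.isLeastFixed m).radius_lt_top hw

theorem IsSteep.rho_succ_lt_of (hw : IsSteep w) (m : ℕ) (hpos : 0 < rho w m)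
    (hG : rho w m < radius (coeffG w m)) : rho w (m + 1) < rho w m := by
  have hpos' : 0 < radius (coeffU w (m + 1)) :=
    (hw.isLeastFixed (m + 1)).radius_pos hw (hpos.trans_le (hw.rho_le_radius_coeffG_succ m))
  have hle : rho w (m + 1) ≤ rho w m := by
    rw [← hw.radius_coeffU, ← hw.radius_coeffU]
    refine radius_anti (C := 1) fun n => ?_
    rw [abs_of_nonneg ((hw.isLeastFixed m).b_nonneg n),
      abs_of_nonneg ((hw.isLeastFixed (m + 1)).b_nonneg n)]
    linarith [hw.two_mul_coeffU_le m n, (hw.isLeastFixed m).b_nonneg n]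
  refine lt_of_le_of_ne hle fun he => ?_
  rw [← hw.radius_coeffU] at hpos hG
  obtain ⟨hs, hU⟩ := (hw.isLeastFixed m).summable_at_radius hw hpos
  obtain ⟨hs', hU'⟩ := (hw.isLeastFixed (m + 1)).summable_at_radius hw hpos'
  have h1 := (hw.isLeastFixed m).slope_eq_one hw hpos hG
  have hx : 0 < (rho w m).toReal := by
    rw [← hw.radius_coeffU]
    exact ENNReal.toReal_pos hpos.ne' ((hw.isLeastFixed m).radius_lt_top hw).ne
  rw [hw.radius_coeffU] at hs hU hs' hU' h1
  rw [he] at hs' hU'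
  have h2 := (hw.isLeastFixed (m + 1)).slope_le_one hw hx hs' hU'
  have h3 : 0 < generator (coeffU w m) (rho w m).toReal := by
    have := term_le_generator (hw.isLeastFixed m).b_nonneg hx.le hs 1
    exact lt_of_lt_of_le (mul_pos (hw.isLeastFixed m).b_one_pos (pow_pos hx 1)) this
  have h4 : 2 * generator (coeffU w m) (rho w m).toReal ≤
      generator (coeffU w (m + 1)) (rho w m).toReal := by
    rw [generator, ← tsum_mul_left]
    refine (hs.mul_left 2).tsum_le_tsum (fun n => ?_) hs'
    rw [← mul_assoc]
    exact mul_le_mul_of_nonneg_right (hw.two_mul_coeffU_le m n) (pow_nonneg hx.le n)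
  have h5 := hw.dcoeff_strictMono h3.le (by linarith) hU'
  have h6 := mul_lt_mul_of_pos_left h5 hx
  linarith

theorem IsSteep.rho_pos_and_lt (hw : IsSteep w) (m : ℕ) :
    0 < rho w m ∧ rho w m < radius (coeffG w m) := by
  induction m with
  | zero =>
    have h := radius_coeffG_zero w
    refine ⟨?_, by rw [h]; exact hw.rho_lt_top 0⟩
    rw [← hw.radius_coeffU]
    exact (hw.isLeastFixed 0).radius_pos hw (by simp [h])
  | succ m ih =>
    refine ⟨?_, (hw.rho_succ_lt_of m ih.1 ih.2).trans_le (hw.rho_le_radius_coeffG_succ m)⟩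
    rw [← hw.radius_coeffU]
    exact (hw.isLeastFixed (m + 1)).radius_pos hw
      (ih.1.trans_le (hw.rho_le_radius_coeffG_succ m))

theorem IsSteep.rho_pos (hw : IsSteep w) (m : ℕ) : 0 < rho w m := (hw.rho_pos_and_lt m).1

theorem IsSteep.rho_succ_lt (hw : IsSteep w) (m : ℕ) : rho w (m + 1) < rho w m :=
  hw.rho_succ_lt_of m (hw.rho_pos m) (hw.rho_pos_and_lt m).2

theorem IsSteep.toReal_rho_pos (hw : IsSteep w) (m : ℕ) : 0 < (rho w m).toReal :=
  ENNReal.toReal_pos (hw.rho_pos m).ne' (hw.rho_lt_top m).ne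

/-! ### The span and the supports of the coefficients -/

/-- The greatest common divisor of the indices of nonzero weights. -/
def span (w : ℕ → ℝ) : ℕ := Nat.setGcd {i | w i ≠ 0}

theorem IsSteep.span_ne_zero (hw : IsSteep w) : span w ≠ 0 := by
  obtain ⟨i, hi, hwi⟩ := hw.exists_two_le
  intro h0
  have : span w ∣ i := Nat.setGcd_dvd_of_mem hwi.ne'
  rw [h0, zero_dvd_iff] at this
  lia

theorem exists_of_treeCoeff_ne_zero {c : OrderedTree → ℝ} {n : ℕ} (h : treeCoeff w c n ≠ 0) :
    ∃ q, n = span w * q + 1 := by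
  have : ∃ T : TreeOfSize n, T.1.weight w ≠ 0 := by
    by_contra! hz
    exact h (by simp [treeCoeff, hz])
  obtain ⟨T, hT⟩ := this
  obtain ⟨q, hq⟩ := size_mod_of_weight_ne_zero (p := span w)
    (fun i hi => Nat.setGcd_dvd_of_mem hi) T.1 hT
  have h1 := T.1.size_pos
  rw [T.2] at hq h1
  exact ⟨q, by lia⟩

theorem IsSteep.coeffU_succ_pos (hw : IsSteep w) (m : ℕ) {k : ℕ} (hk : 0 < w k) :
    0 < coeffU w m (k + 1) := by
  set leaf := joinTrees (Fin.elim0 : Fin 0 → OrderedTree) with hleaf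
  have hl1 : leaf.size = 1 := by simp [hleaf, size_joinTrees]
  have hl2 : leaf.weight w = w 0 := by simp [hleaf, weight_joinTrees]
  set T := joinTrees (fun _ : Fin k => leaf) with hT
  have hs : T.size = k + 1 := by simp [hT, size_joinTrees, hl1, add_comm]
  have hwt : T.weight w = w k * w 0 ^ k := by simp [hT, weight_joinTrees, hl2]
  have hc : ∀ T : OrderedTree, 0 < (T.numRoot + 1) ^ m := fun T =>
    pow_pos (by linarith [T.numRoot_nonneg]) m
  have h := le_treeCoeff hw.nonneg (fun T => (hc T).le) T
  rw [hs, hwt] at h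
  exact lt_of_lt_of_le (mul_pos (mul_pos hk (pow_pos hw.zero_pos k)) (hc T)) h

theorem psum_phase {b : ℕ → ℝ} (hb : ∀ n, 0 ≤ b n) {z : ℂ}
    (hs : Summable fun n => b n * ‖z‖ ^ n) (h0 : 0 < generator b ‖z‖)
    (heq : ‖psum b z‖ = generator b ‖z‖) :
    ∃ e : ℂ, e ≠ 0 ∧ ∀ n, 0 < b n → z ^ n = e * ‖z‖ ^ n := by
  set V := psum b z with hV
  set u := generator b ‖z‖ with hu
  have hsz : Summable fun n => (b n : ℂ) * z ^ n :=
    summable_psum (by simpa only [abs_of_nonneg (hb _)] using hs)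
  have hu0 : (u : ℂ) ≠ 0 := by exact_mod_cast h0.ne'
  set e := V / u with he
  have hen : ‖e‖ = 1 := by
    rw [he, norm_div, heq, Complex.norm_real, Real.norm_of_nonneg h0.le, div_self h0.ne']
  have hconj : e * (starRingEnd ℂ) e = 1 := by
    rw [Complex.mul_conj, Complex.normSq_eq_norm_sq, hen]
    simp
  have h1 : HasSum (fun n => b n * ‖z‖ ^ n - ((starRingEnd ℂ) e * ((b n : ℂ) * z ^ n)).re)
      (u - ((starRingEnd ℂ) e * V).re) :=
    hs.hasSum.sub (Complex.hasSum_re (hsz.hasSum.mul_left _))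
  have h2 : u - ((starRingEnd ℂ) e * V).re = 0 := by
    have : (starRingEnd ℂ) e * V = u := by
      have hVe : V = e * u := by rw [he, div_mul_cancel₀ _ hu0]
      rw [hVe, ← mul_assoc, mul_comm _ e, hconj, one_mul]
    rw [this]
    simp
  have hre : ∀ n, ((starRingEnd ℂ) e * ((b n : ℂ) * z ^ n)).re =
      b n * ((starRingEnd ℂ) e * z ^ n).re := fun n => by
    rw [← Complex.re_ofReal_mul]
    ring_nf
  have hnorm : ∀ n, ‖(starRingEnd ℂ) e * z ^ n‖ = ‖z‖ ^ n := fun n => by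
    rw [norm_mul, RCLike.norm_conj, hen, one_mul, norm_pow]
  rw [h2] at h1
  have h3 := (hasSum_zero_iff_of_nonneg (fun n => by
    rw [hre, sub_nonneg]
    refine mul_le_mul_of_nonneg_left ?_ (hb n)
    rw [← hnorm n]
    exact Complex.re_le_norm _)).1 h1
  refine ⟨e, norm_ne_zero_iff.1 (by rw [hen]; exact one_ne_zero), fun n hn => ?_⟩
  have h4 := congrFun h3 n
  simp only [hre, Pi.zero_apply] at h4
  have h5 : ((starRingEnd ℂ) e * z ^ n).re = ‖z‖ ^ n := by
    have h6 : b n * (‖z‖ ^ n - ((starRingEnd ℂ) e * z ^ n).re) = 0 := by linarith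
    linarith [(mul_eq_zero.1 h6).resolve_left hn.ne']
  have h7 : (starRingEnd ℂ) e * z ^ n = (‖(starRingEnd ℂ) e * z ^ n‖ : ℝ) := by
    have h8 := (Complex.nonneg_iff.1 (Complex.re_eq_norm.1 (h5.trans (hnorm n).symm))).2
    exact Complex.ext (by rw [h5, hnorm, Complex.ofReal_re]) (by rw [← h8, Complex.ofReal_im])
  rw [hnorm] at h7
  calc z ^ n = e * (starRingEnd ℂ) e * z ^ n := by rw [hconj, one_mul]
    _ = e * ‖z‖ ^ n := by rw [mul_assoc, h7]; push_cast; rfl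

end

section

/-! ### Asymptotics of the coefficients -/

theorem psum_complex_ofReal (a : ℕ → ℝ) (x : ℝ) : psum a (x : ℂ) = (generator a x : ℂ) :=
  psum_ofReal a x

theorem iteratedDeriv_psum {a : ℕ → ℝ} (ha : 0 < radius a) (n : ℕ) :
    iteratedDeriv n (psum a : ℂ → ℂ) 0 / n.factorial = a n := by
  set p := FormalMultilinearSeries.ofScalars ℂ (fun n => (a n : ℂ)) with hp
  have hr : 0 < p.radius := by
    obtain ⟨x, -, hx, hxr⟩ := exists_lt_of_ofReal_lt (x := 0) (by simpa using ha)
    have hs := summable_of_lt_radius hx.le hxr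
    refine (ENNReal.ofReal_pos.2 hx).trans_le (p.le_radius_of_summable (r := x.toNNReal) ?_)
    simpa [hp, FormalMultilinearSeries.ofScalars_norm, Real.coe_toNNReal _ hx.le] using hs
  have h := (p.hasFPowerSeriesOnBall hr).hasFPowerSeriesAt
  have hsum : p.sum = psum a := by
    ext z
    simp [hp, FormalMultilinearSeries.sum, psum, mul_comm]
  rw [hsum] at h
  exact iteratedDeriv_eq_of_hasFPowerSeriesAt (c := fun n => (a n : ℂ)) h n

open Metric

theorem continuousOn_psum {b : ℕ → ℝ} (hb : ∀ n, 0 ≤ b n) {ρ : ℝ}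
    (hs : Summable fun n => b n * ρ ^ n) : ContinuousOn (psum b : ℂ → ℂ) (closedBall 0 ρ) := by
  refine continuousOn_tsum (fun n => by fun_prop) hs fun n z hz => ?_
  rw [norm_coeff_mul_pow, abs_of_nonneg (hb n)]
  have : ‖z‖ ≤ ρ := by simpa using hz
  exact mul_le_mul_of_nonneg_left (pow_le_pow_left₀ (norm_nonneg _) this n) (hb n)

theorem norm_psum_le_generator {b : ℕ → ℝ} (hb : ∀ n, 0 ≤ b n) {ρ : ℝ}
    (hs : Summable fun n => b n * ρ ^ n) {z : ℂ} (hz : z ∈ closedBall (0 : ℂ) ρ) :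
    ‖psum b z‖ ≤ generator b ρ := by
  have hz' : ‖z‖ ≤ ρ := by simpa using hz
  exact (norm_psum_le hb (summable_mono hb (norm_nonneg z) hz' hs)).trans
    (generator_mono hb (norm_nonneg z) hz' hs)

variable {w g a b : ℕ → ℝ}

theorem IsLeastFixed.psum_eq (h : IsLeastFixed w g a b) {ρ : ℝ}
    (hρ : 0 < ρ) (hρb : radius b = ENNReal.ofReal ρ) (hs : Summable fun n => b n * ρ ^ n)
    (hU : ENNReal.ofReal (generator b ρ) < radius w) (hg : ENNReal.ofReal ρ < radius g)
    {z : ℂ} (hz : z ∈ closedBall (0 : ℂ) ρ) :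
    psum b z = z * psum w (psum b z) + psum g z := by
  have hΦ : ∀ z ∈ closedBall (0 : ℂ) ρ, AnalyticAt ℂ (psum w) (psum b z) := fun z hz =>
    analyticAt_psum ((ENNReal.ofReal_le_ofReal (norm_psum_le_generator h.b_nonneg hs hz)).trans_lt
      hU)
  have hG : ∀ z ∈ closedBall (0 : ℂ) ρ, AnalyticAt ℂ (psum g) z := fun z hz =>
    analyticAt_psum ((ENNReal.ofReal_le_ofReal (by simpa using hz)).trans_lt hg)
  have hb : ∀ z ∈ ball (0 : ℂ) ρ, AnalyticAt ℂ (psum b) z := fun z hz =>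
    analyticAt_psum (by
      rw [hρb]
      exact (ENNReal.ofReal_lt_ofReal_iff hρ).2 (by simpa using hz))
  have hcb := continuousOn_psum h.b_nonneg hs
  have hcr : ContinuousOn (fun z : ℂ => z * psum w (psum b z) + psum g z) (closedBall 0 ρ) := by
    refine (continuousOn_id.mul ?_).add fun z hz => (hG z hz).continuousAt.continuousWithinAt
    intro z hz
    exact ContinuousAt.comp_continuousWithinAt (f := psum b) (hΦ z hz).continuousAt (hcb z hz)
  have han1 : AnalyticOnNhd ℂ (psum b : ℂ → ℂ) (ball 0 ρ) := hb
  have han2 : AnalyticOnNhd ℂ (fun z : ℂ => z * psum w (psum b z) + psum g z) (ball 0 ρ) := by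
    intro z hz
    refine (analyticAt_id.mul ?_).add (hG z (ball_subset_closedBall hz))
    exact AnalyticAt.fun_comp (hΦ z (ball_subset_closedBall hz)) (hb z hz)
  have hreal : ∀ᶠ x : ℝ in 𝓝[>] 0, psum b (x : ℂ) =
      (x : ℂ) * psum w (psum b (x : ℂ)) + psum g (x : ℂ) := by
    filter_upwards [Ioo_mem_nhdsGT hρ] with x hx
    have hsx := summable_mono h.b_nonneg hx.1.le hx.2.le hs
    have h1 := h.generator_eq hx.1.le hsx
    rw [(h.fixed x hx.1.le hsx).2] at h1
    rw [psum_complex_ofReal, psum_complex_ofReal, psum_complex_ofReal]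
    exact_mod_cast h1
  have hmap : Tendsto (fun x : ℝ => (x : ℂ)) (𝓝[>] 0) (𝓝[≠] 0) := by
    refine tendsto_nhdsWithin_iff.2 ⟨?_, ?_⟩
    · exact (Complex.continuous_ofReal.tendsto' 0 0 (by simp)).mono_left nhdsWithin_le_nhds
    · filter_upwards [self_mem_nhdsWithin] with x hx
      simpa using (ne_of_gt hx)
  have heq := han1.eqOn_of_preconnected_of_frequently_eq han2
    (convex_ball (0 : ℂ) ρ).isPreconnected (by simpa using hρ : (0 : ℂ) ∈ ball (0 : ℂ) ρ)
    (hmap.frequently hreal.frequently)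
  have hcl : closedBall (0 : ℂ) ρ ⊆ closure (ball 0 ρ) := by
    rw [closure_ball _ hρ.ne']
  exact heq.of_subset_closure hcb hcr ball_subset_closedBall hcl hz

/-- The coefficients of the power series `f` with `F(z) = z f((z/ρ)^d)`, where `d` is the span. -/
def spanCoeff (w : ℕ → ℝ) (m q : ℕ) : ℝ :=
  coeffF w m (span w * q + 1) * (rho w m).toReal ^ (span w * q)

theorem IsSteep.norm_psum_coeffU_lt (hw : IsSteep w) (m : ℕ) {ρ : ℝ} (hρ : 0 < ρ)
    (hs : Summable fun n => coeffU w m n * ρ ^ n) {z : ℂ} (hz : ‖z‖ = ρ)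
    (hzd : (z / ρ) ^ span w ≠ 1) : ‖psum (coeffU w m) z‖ < generator (coeffU w m) ρ := by
  have h := hw.isLeastFixed m
  have hρ' : (ρ : ℂ) ≠ 0 := by exact_mod_cast hρ.ne'
  refine lt_of_le_of_ne (norm_psum_le_generator h.b_nonneg hs (by simp [hz])) fun heq => hzd ?_
  have hpos : 0 < generator (coeffU w m) ρ :=
    (mul_pos h.b_one_pos (pow_pos hρ 1)).trans_le (term_le_generator h.b_nonneg hρ.le hs 1)
  obtain ⟨e, he0, he⟩ := psum_phase h.b_nonneg (z := z) (by rwa [hz]) (by rwa [hz])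
    (by rwa [hz])
  rw [hz] at he
  have hz1 : z / ρ = e := by
    have := he 1 h.b_one_pos
    rw [pow_one, pow_one] at this
    rw [this, mul_div_cancel_right₀ _ hρ']
  rw [hz1]
  have hk : ∀ k, w k ≠ 0 → e ^ k = 1 := by
    intro k hk
    have h1 := he (k + 1) (hw.coeffU_succ_pos m (lt_of_le_of_ne (hw.nonneg k) hk.symm))
    have h2 : z = e * ρ := by rw [← hz1, div_mul_cancel₀ _ hρ']
    rw [h2, mul_pow] at h1
    have h3 := mul_right_cancel₀ (pow_ne_zero _ hρ') h1
    rw [pow_succ] at h3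
    exact mul_right_cancel₀ he0 (by rw [h3, one_mul])
  rw [← orderOf_dvd_iff_pow_eq_one]
  exact Nat.dvd_setGcd_iff.2 fun k hk' => orderOf_dvd_iff_pow_eq_one.2 (hk k hk')

theorem IsSteep.spanCoeff_nonneg (hw : IsSteep w) (m q : ℕ) : 0 ≤ spanCoeff w m q :=
  mul_nonneg ((hw.isLeastFixed m).a_nonneg _) (pow_nonneg ENNReal.toReal_nonneg _)

theorem IsSteep.psum_spanCoeff (hw : IsSteep w) (m : ℕ) (z : ℂ) :
    z * psum (spanCoeff w m) ((z / (rho w m).toReal) ^ span w) = psum (coeffF w m) z := by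
  have hρ : ((rho w m).toReal : ℂ) ≠ 0 := by exact_mod_cast (hw.toReal_rho_pos m).ne'
  have hinj : Function.Injective fun q => span w * q + 1 := fun q q' h => by
    simpa [hw.span_ne_zero] using h
  rw [psum, psum, ← tsum_mul_left]
  refine Eq.trans ?_ (hinj.tsum_eq ?_)
  · refine tsum_congr fun q => ?_
    rw [spanCoeff, ← pow_mul, div_pow, pow_succ]
    simp only [Complex.coe_algebraMap, Complex.ofReal_mul, Complex.ofReal_pow]
    field_simp
  · intro n hn
    have : coeffF w m n ≠ 0 := by
      intro h0
      simp [h0] at hn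
    rw [coeffF_eq] at this
    obtain ⟨q, hq⟩ := exists_of_treeCoeff_ne_zero this
    exact ⟨q, hq.symm⟩

theorem IsSteep.exists_spanCoeff_isBigO (hw : IsSteep w) (m : ℕ) :
    ∃ c : ℂ, c ≠ 0 ∧ (fun q => (spanCoeff w m q : ℂ) - c * sqrtCoeff 1 q) =O[atTop]
      fun q : ℕ => -sqrtCoeff 1 q / (q : ℝ) := by
  have h := hw.isLeastFixed m
  have hr := hw.rho_pos m
  have hrt := hw.rho_lt_top m
  have hρ := hw.toReal_rho_pos m
  have hrG := (hw.rho_pos_and_lt m).2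
  obtain ⟨hs, hU⟩ := h.summable_at_radius hw (by rwa [hw.radius_coeffU])
  have hslope := h.slope_eq_one hw (by rwa [hw.radius_coeffU]) (by rwa [hw.radius_coeffU])
  rw [hw.radius_coeffU] at hs hU hslope
  have hρr : ENNReal.ofReal (rho w m).toReal = rho w m := ENNReal.ofReal_toReal hrt.ne
  have hsz := fun z => hw.psum_spanCoeff m z
  set ρ := (rho w m).toReal with hρdef
  set f := spanCoeff w m with hf
  have hρ' : (ρ : ℂ) ≠ 0 := by exact_mod_cast hρ.ne'
  rw [← hρr] at hrG
  have hfix : ∀ z ∈ closedBall (0 : ℂ) ρ, _ := fun z hz =>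
    h.psum_eq hρ (by rw [hw.radius_coeffU, hρr]) hs hU hrG hz
  have hU0 : 0 < generator (coeffU w m) ρ :=
    (mul_pos h.b_one_pos (pow_pos hρ 1)).trans_le (term_le_generator h.b_nonneg hρ.le hs 1)
  have hUlt : ∀ z ∈ closedBall (0 : ℂ) ρ, ENNReal.ofReal ‖psum (coeffU w m) z‖ < radius w :=
    fun z hz => (ENNReal.ofReal_le_ofReal (norm_psum_le_generator h.b_nonneg hs hz)).trans_lt hU
  have hUρ : ENNReal.ofReal ‖(psum (coeffU w m) (ρ : ℂ) : ℂ)‖ < radius w :=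
    hUlt ρ (by simp [abs_of_pos hρ])
  have hdw := dcoeff_nonneg hw.nonneg
  have hrad1 : 1 ≤ radius f := by
    rw [← ENNReal.ofReal_one]
    refine le_radius_of_summable (hw.spanCoeff_nonneg m) zero_le_one ?_
    have hinj : Function.Injective fun q => span w * q + 1 := fun q q' h => by
      simpa [hw.span_ne_zero] using h
    refine (((h.summable_a hρ.le hs).comp_injective hinj).mul_left ρ⁻¹).congr fun q => ?_
    simp only [Function.comp_apply, spanCoeff, one_pow, mul_one, pow_succ, ← hρdef]
    field_simp
  have hfan : AnalyticOnNhd ℂ (psum f : ℂ → ℂ) (ball 0 1) := fun u hu =>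
    analyticAt_psum (lt_of_lt_of_le (by
      rw [← ENNReal.ofReal_one]
      exact (ENNReal.ofReal_lt_ofReal_iff one_pos).2 (by simpa using hu)) hrad1)
  have hUc := continuousOn_psum h.b_nonneg hs
  have hfU : ∀ z ∈ ball (0 : ℂ) ρ, psum f ((z / ρ) ^ span w) = psum w (psum (coeffU w m) z) := by
    have hne : ∀ z ∈ ball (0 : ℂ) ρ, z ≠ 0 →
        psum f ((z / ρ) ^ span w) = psum w (psum (coeffU w m) z) := by
      intro z hz hz0
      have e1 := hfix z (ball_subset_closedBall hz)
      have hzr : ‖z‖ < ρ := by simpa using hz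
      have hsb := summable_mono h.b_nonneg (norm_nonneg z) hzr.le hs
      have e2 : psum (coeffU w m) z = psum (coeffF w m) z + psum (coeffG w m) z := by
        rw [psum, psum, psum, ← Summable.tsum_add]
        · exact tsum_congr fun n => by rw [h.b_eq]; push_cast; ring
        · exact summable_psum (by
            simpa only [abs_of_nonneg (h.a_nonneg _)] using h.summable_a (norm_nonneg z) hsb)
        · exact summable_psum (by
            simpa only [abs_of_nonneg (h.g_nonneg _)] using h.summable_g (norm_nonneg z) hsb)
      refine mul_left_cancel₀ hz0 ?_
      rw [hsz]
      linear_combination e1 - e2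
    intro z hz
    by_cases hz0 : z = 0
    · subst hz0
      have c1 : ContinuousAt (fun z : ℂ => psum f ((z / ρ) ^ span w)) 0 := by
        refine ContinuousAt.comp' (f := fun z : ℂ => (z / ρ) ^ span w) ?_ (by fun_prop)
        refine (hfan _ ?_).continuousAt
        simp [hw.span_ne_zero]
      have c2 : ContinuousAt (fun z : ℂ => psum w (psum (coeffU w m) z)) 0 := by
        refine ContinuousAt.comp' (f := psum (coeffU w m))
          (analyticAt_psum (hUlt 0 (by simpa using hρ.le))).continuousAt ?_
        exact (hUc.mono ball_subset_closedBall).continuousAt (isOpen_ball.mem_nhds hz)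
      refine tendsto_nhds_unique (c1.tendsto.mono_left (nhdsWithin_le_nhds (s := {0}ᶜ)))
        ((c2.tendsto.mono_left (nhdsWithin_le_nhds (s := {0}ᶜ))).congr' ?_)
      filter_upwards [self_mem_nhdsWithin, mem_nhdsWithin_of_mem_nhds (isOpen_ball.mem_nhds hz)]
        with z h1 h2
      exact (hne z h2 h1).symm
    · exact hne z hz hz0
  have hreg : ∀ z : ℂ, ‖z‖ = ρ → (z / ρ) ^ span w ≠ 1 →
      z * deriv (psum w) (psum (coeffU w m) z) ≠ 1 := by
    intro z hz hzd h1
    have hmem : z ∈ closedBall (0 : ℂ) ρ := by simp [hz]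
    have hlt := hw.norm_psum_coeffU_lt m hρ hs hz hzd
    rw [deriv_psum (hUlt z hmem)] at h1
    have e1 : ‖psum (dcoeff w) (psum (coeffU w m) z)‖ ≤
        generator (dcoeff w) ‖psum (coeffU w m) z‖ :=
      norm_psum_le hdw (summable_of_nonneg_of_lt_radius hdw (norm_nonneg _)
        ((hUlt z hmem).trans_le (radius_le_radius_dcoeff w)))
    have e2 := hw.dcoeff_strictMono (norm_nonneg _) hlt hU
    have e3 := congrArg norm h1
    rw [norm_mul, hz, norm_one] at e3
    have e4 := mul_lt_mul_of_pos_left (e1.trans_lt e2) hρ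
    rw [e3, hslope] at e4
    exact lt_irrefl _ e4
  have hcrit : (ρ : ℂ) * deriv (psum w) (psum (coeffU w m) (ρ : ℂ)) = 1 := by
    rw [deriv_psum hUρ, psum_complex_ofReal, psum_complex_ofReal]
    exact_mod_cast hslope
  have hcurv : deriv (deriv (psum w)) (psum (coeffU w m) (ρ : ℂ)) ≠ 0 := by
    rw [deriv_deriv_psum hUρ, psum_complex_ofReal, psum_complex_ofReal]
    obtain ⟨i, hi, hwi⟩ := hw.exists_two_le
    obtain ⟨i, rfl⟩ := Nat.exists_eq_add_of_le' hi
    have hd2 := dcoeff_nonneg hdw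
    have hpos : 0 < dcoeff (dcoeff w) i * generator (coeffU w m) ρ ^ i := by
      simp only [dcoeff]
      positivity
    have := hpos.trans_le (term_le_generator hd2 hU0.le (summable_of_nonneg_of_lt_radius hd2 hU0.le
      (hU.trans_le ((radius_le_radius_dcoeff w).trans (radius_le_radius_dcoeff _)))) i)
    exact_mod_cast this.ne'
  have hdiff : psum w (psum (coeffU w m) (ρ : ℂ)) + deriv (psum (coeffG w m)) (ρ : ℂ) ≠ 0 := by
    rw [deriv_psum (by simpa [abs_of_pos hρ] using hrG), psum_complex_ofReal, psum_complex_ofReal,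
      psum_complex_ofReal]
    have e1 := term_le_generator hw.nonneg hU0.le
      (summable_of_nonneg_of_lt_radius hw.nonneg hU0.le hU) 0
    rw [pow_zero, mul_one] at e1
    have e2 : 0 ≤ generator (dcoeff (coeffG w m)) ρ :=
      generator_nonneg (dcoeff_nonneg h.g_nonneg) hρ.le
    have e3 : 0 < generator w (generator (coeffU w m) ρ) + generator (dcoeff (coeffG w m)) ρ := by
      linarith [hw.zero_pos]
    exact_mod_cast e3.ne'
  obtain ⟨c, hc0, hc⟩ := exists_coeff_isBigO_of_critical (Φ := psum w) (G := psum (coeffG w m))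
    (U := psum (coeffU w m)) (f := psum f) hw.span_ne_zero hρ hUc
    (fun z hz => analyticAt_psum (hUlt z hz))
    (fun z hz => analyticAt_psum
      ((ENNReal.ofReal_le_ofReal (by simpa using hz)).trans_lt hrG)) hfix hreg hcrit hcurv
    hdiff hfan hfU
  refine ⟨c, hc0, ?_⟩
  simpa only [iteratedDeriv_psum (one_pos.trans_le hrad1)] using hc

end

/-! ### Moments of simply generated trees -/

theorem sqrtCoeff_one_ne_zero (q : ℕ) : sqrtCoeff 1 q ≠ 0 := by
  rcases Nat.eq_zero_or_pos q with rfl | h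
  · simp [sqrtCoeff]
  · exact (neg_pos.1 (neg_sqrtCoeff_pos h)).ne

theorem exists_pos_of_isBigO {f : ℕ → ℝ} (hf : ∀ q, 0 ≤ f q) {c : ℂ} (hc : c ≠ 0)
    (h : (fun q => (f q : ℂ) - c * sqrtCoeff 1 q) =O[atTop]
      fun q : ℕ => -sqrtCoeff 1 q / (q : ℝ)) :
    ∃ r : ℝ, 0 < r ∧ (fun q => f q / (r * -sqrtCoeff 1 q) - 1) =O[atTop]
      fun q : ℕ => (1 : ℝ) / q := by
  have h1 : (fun q => ((f q / -sqrtCoeff 1 q : ℝ) : ℂ) - -c) =O[atTop]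
      fun q : ℕ => (1 : ℝ) / q := by
    have h2 : (fun q => ((-sqrtCoeff 1 q)⁻¹ : ℝ)) =O[atTop] fun q => (-sqrtCoeff 1 q)⁻¹ :=
      isBigO_refl _ _
    have h3 := h2.smul h
    refine h3.congr (fun q => ?_) fun q => ?_
    · have : (sqrtCoeff 1 q : ℂ) ≠ 0 := by exact_mod_cast sqrtCoeff_one_ne_zero q
      rw [Complex.real_smul]
      push_cast
      field_simp
      ring
    · have := sqrtCoeff_one_ne_zero q
      rw [smul_eq_mul]
      field_simp
  have hlim : Tendsto (fun q : ℕ => (1 : ℝ) / q) atTop (𝓝 0) := tendsto_one_div_atTop_nhds_zero_nat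
  have h2 : Tendsto (fun q => ((f q / -sqrtCoeff 1 q : ℝ) : ℂ)) atTop (𝓝 (-c)) := by
    have := (h1.trans_tendsto hlim).add_const (-c)
    simpa using this
  have hre := (Complex.continuous_re.tendsto _).comp h2
  have him := (Complex.continuous_im.tendsto _).comp h2
  simp only [Function.comp_def, Complex.ofReal_re, Complex.ofReal_im] at hre him
  have him0 : (-c).im = 0 := (tendsto_nhds_unique him tendsto_const_nhds)
  have hcr : -c = ((-c).re : ℂ) := Complex.ext (by simp) (by simpa using him0)
  have hr0 : 0 ≤ (-c).re := by
    refine ge_of_tendsto hre ?_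
    filter_upwards [eventually_gt_atTop 0] with q hq
    exact div_nonneg (hf q) (neg_sqrtCoeff_pos hq).le
  have hrne : (-c).re ≠ 0 := by
    intro h0
    rw [h0] at hcr
    exact hc (by simpa using hcr)
  set r := (-c).re with hr
  refine ⟨r, lt_of_le_of_ne hr0 hrne.symm, ?_⟩
  have h4 : (fun q => f q / -sqrtCoeff 1 q - r) =O[atTop] fun q : ℕ => (1 : ℝ) / q := by
    refine IsBigO.trans (isBigO_of_le _ fun q => ?_) h1
    rw [hcr, ← Complex.ofReal_sub, Complex.norm_real]
  refine (h4.const_mul_left r⁻¹).congr_left fun q => ?_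
  have := sqrtCoeff_one_ne_zero q
  field_simp

theorem isBigO_div_sub_one {X Y : ℕ → ℝ}
    (hX : (fun q => X q - 1) =O[atTop] fun q : ℕ => (1 : ℝ) / q)
    (hY : (fun q => Y q - 1) =O[atTop] fun q : ℕ => (1 : ℝ) / q) :
    (fun q => X q / Y q - 1) =O[atTop] fun q : ℕ => (1 : ℝ) / q := by
  have hY1 : Tendsto Y atTop (𝓝 1) := by
    have := (hY.trans_tendsto tendsto_one_div_atTop_nhds_zero_nat).add_const 1
    simpa using this
  have hinv : (fun q => (Y q)⁻¹) =O[atTop] fun _ => (1 : ℝ) :=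
    (hY1.inv₀ one_ne_zero).isBigO_one ℝ
  have h := (hX.sub hY).mul hinv
  simp only [mul_one] at h
  refine h.congr' ?_ EventuallyEq.rfl
  filter_upwards [hY1.eventually_ne one_ne_zero] with q hq
  field_simp
  ring

theorem isBigO_comp_div {ε : ℕ → ℝ} (hε : ε =O[atTop] fun q : ℕ => (1 : ℝ) / q) {d : ℕ}
    (hd : d ≠ 0) : (fun n => ε ((n - 1) / d)) =O[atTop] fun n : ℕ => (1 : ℝ) / n := by
  have ht : Tendsto (fun n : ℕ => (n - 1) / d) atTop atTop :=
    (Nat.tendsto_div_const_atTop hd).comp (tendsto_sub_atTop_nat 1)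
  refine (hε.comp_tendsto ht).trans (IsBigO.of_bound (2 * d) ?_)
  filter_upwards [ht.eventually_ge_atTop 1, eventually_gt_atTop 0] with n hq hn
  have h1 : n - 1 < d * ((n - 1) / d) + d := Nat.lt_mul_div_succ (n - 1) (Nat.pos_of_ne_zero hd)
  have h2 : n ≤ 2 * d * ((n - 1) / d) := by
    have h0 : d ≤ d * ((n - 1) / d) := Nat.le_mul_of_pos_right d hq
    rw [mul_assoc]
    lia
  have h3 : (n : ℝ) ≤ 2 * d * ((n - 1) / d : ℕ) := by exact_mod_cast h2
  have h4 : (0 : ℝ) < ((n - 1) / d : ℕ) := by exact_mod_cast hq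
  have h5 : (0 : ℝ) < n := by exact_mod_cast hn
  rw [Function.comp_apply, Real.norm_of_nonneg (by positivity), Real.norm_of_nonneg (by positivity),
    mul_one_div, div_le_div_iff₀ h4 h5, one_mul]
  exact h3

theorem totalWeight_eq (w : ℕ → ℝ) (n : ℕ) : totalWeight w n = coeffF w 0 n := by
  simp [totalWeight, coeffF]

theorem simplyGeneratedMoment_eq (w : ℕ → ℝ) (m n : ℕ) :
    simplyGeneratedMoment w m n = coeffF w m n / totalWeight w n := by
  rw [simplyGeneratedMoment, coeffF, ← tsum_div_const]
  exact tsum_congr fun T => by rw [simplyGeneratedProb]; ring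

theorem IsSteep.momentAsymptotics {w : ℕ → ℝ} (hw : IsSteep w) :
    MomentAsymptotics (simplyGeneratedMoment w) {n | 0 < totalWeight w n} (rho w) := by
  have hex : ∀ m, ∃ r : ℝ, 0 < r ∧ (fun q => spanCoeff w m q / (r * -sqrtCoeff 1 q) - 1) =O[atTop]
      fun q : ℕ => (1 : ℝ) / q := fun m => by
    obtain ⟨c, hc0, hc⟩ := hw.exists_spanCoeff_isBigO m
    exact exists_pos_of_isBigO (hw.spanCoeff_nonneg m) hc0 hc
  choose r hr hX using hex
  have hρ := hw.toReal_rho_pos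
  have hρlt : ∀ m, (rho w (m + 1)).toReal < (rho w m).toReal := fun m =>
    (ENNReal.toReal_lt_toReal (hw.rho_lt_top _).ne (hw.rho_lt_top _).ne).2 (hw.rho_succ_lt m)
  refine ⟨fun m => r m * (rho w m).toReal / (r 0 * (rho w 0).toReal),
    fun m => (rho w 0).toReal / (rho w m).toReal, fun m _ => ?_, ?_, fun m _ => ?_,
    fun m => ⟨hw.rho_pos m, hw.rho_lt_top m⟩, fun m _ => rfl, fun m _ => ?_⟩
  · exact div_pos (mul_pos (hr m) (hρ m)) (mul_pos (hr 0) (hρ 0))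
  · exact (one_lt_div (hρ 1)).2 (hρlt 0)
  · exact div_lt_div_of_pos_left (hρ 0) (hρ (m + 1)) (hρlt m)
  · set X : ℕ → ℕ → ℝ := fun m q => spanCoeff w m q / (r m * -sqrtCoeff 1 q) with hXdef
    refine ⟨fun n => X m ((n - 1) / span w) / X 0 ((n - 1) / span w) - 1,
      isBigO_comp_div (isBigO_div_sub_one (hX m) (hX 0)) hw.span_ne_zero, fun n hn => ?_⟩
    rw [Set.mem_ofPred_eq, totalWeight_eq] at hn
    obtain ⟨q, rfl⟩ := exists_of_treeCoeff_ne_zero (coeffF_eq w 0 ▸ hn.ne')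
    rw [simplyGeneratedMoment_eq, totalWeight_eq]
    have hq : (span w * q + 1 - 1) / span w = q := by
      rw [Nat.add_sub_cancel, Nat.mul_div_cancel_left _ (Nat.pos_of_ne_zero hw.span_ne_zero)]
    simp only [hq, hXdef, spanCoeff]
    have h1 := sqrtCoeff_one_ne_zero q
    have h2 := (hr m).ne'
    have h3 := (hr 0).ne'
    have h4 := (hρ m).ne'
    have h5 := (hρ 0).ne'
    have h6 := hn.ne'
    rw [add_sub_cancel, div_pow, pow_succ, pow_succ]
    field_simp

theorem MomentAsymptotics.congr {E E' : ℕ → ℕ → ℝ} {N : Set ℕ} {ρ : ℕ → ℝ≥0∞}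
    (h : MomentAsymptotics E N ρ) (hE : ∀ m, ∀ n ∈ N, E' m n = E m n) :
    MomentAsymptotics E' N ρ := by
  obtain ⟨γ, τ, h1, h2, h3, h4, h5, h6⟩ := h
  refine ⟨γ, τ, h1, h2, h3, h4, h5, fun m hm => ?_⟩
  obtain ⟨ε, hε, hn⟩ := h6 m hm
  exact ⟨ε, hε, fun n hnN => by rw [hE m n hnN, hn n hnN]⟩

section

/-! ### Conditioned Galton-Watson trees -/

theorem nil_mem_treeOfDegrees (x : List ℕ → ℕ) : [] ∈ treeOfDegrees x := by
  intro v i h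
  simp at h

theorem concat_mem_treeOfDegrees (x : List ℕ → ℕ) (u : List ℕ) (i : ℕ) :
    u ++ [i] ∈ treeOfDegrees x ↔ u ∈ treeOfDegrees x ∧ i < x u := by
  simp only [treeOfDegrees, Set.mem_ofPred_eq, List.prefix_concat_iff]
  constructor
  · exact fun h => ⟨fun v j hv => h v j (Or.inr hv), h u i (Or.inl rfl)⟩
  · rintro ⟨h1, h2⟩ v j (h | h)
    · obtain ⟨rfl, h3⟩ := List.append_inj' h rfl
      rwa [(List.cons.inj h3).1]
    · exact h1 v j h

theorem treeOfDegrees_eq_iff (x : List ℕ → ℕ) (T : OrderedTree) :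
    treeOfDegrees x = T.nodes ↔ ∀ v ∈ T.nodes, x v = T.outDegree v := by
  constructor
  · intro h v hv
    refine ((T.outDegree_eq_iff v _).2 fun i => ?_).symm
    rw [← Finset.mem_coe, ← h, concat_mem_treeOfDegrees, h]
    exact ⟨fun h => h.2, fun h => ⟨hv, h⟩⟩
  · intro h
    ext u
    rw [Finset.mem_coe]
    induction u using List.reverseRecOn with
    | nil => exact ⟨fun _ => T.root_mem, fun _ => nil_mem_treeOfDegrees x⟩
    | append_singleton u i ih =>
      rw [concat_mem_treeOfDegrees, ih]
      constructor
      · rintro ⟨h1, h2⟩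
        rw [h u h1] at h2
        exact (T.lt_outDegree_iff u i).1 h2
      · intro h1
        have h2 := T.parent_mem u i h1
        exact ⟨h2, by rw [h u h2]; exact (T.lt_outDegree_iff u i).2 h1⟩

theorem exists_tree_of_encard_eq {x : List ℕ → ℕ} {n : ℕ} (h : (treeOfDegrees x).encard = n) :
    ∃ T : TreeOfSize n, treeOfDegrees x = T.1.nodes := by
  have hfin : (treeOfDegrees x).Finite := Set.finite_of_encard_eq_coe h
  refine ⟨⟨⟨hfin.toFinset, ?_, fun v i hv => ?_, fun v i j hij hv => ?_⟩, ?_⟩, by simp⟩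
  · simpa using nil_mem_treeOfDegrees x
  · rw [Set.Finite.mem_toFinset, concat_mem_treeOfDegrees] at hv
    simpa using hv.1
  · rw [Set.Finite.mem_toFinset, concat_mem_treeOfDegrees] at hv ⊢
    exact ⟨hv.1, hij.trans hv.2⟩
  · rw [hfin.encard_eq_coe_toFinset_card] at h
    exact_mod_cast h

variable {Ω : Type*}

/-- The event that the Galton-Watson tree is `T`. -/
def treeEvent (ξ : List ℕ → Ω → ℕ) (T : OrderedTree) : Set Ω :=
  {ω | treeOfDegrees (fun v => ξ v ω) = T.nodes}

theorem treeEvent_eq (ξ : List ℕ → Ω → ℕ) (T : OrderedTree) :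
    treeEvent ξ T = ⋂ v ∈ T.nodes, ξ v ⁻¹' {T.outDegree v} := by
  ext ω
  simp [treeEvent, treeOfDegrees_eq_iff]

theorem sizeEvent_eq (ξ : List ℕ → Ω → ℕ) (n : ℕ) :
    sizeEvent ξ n = ⋃ T : TreeOfSize n, treeEvent ξ T.1 := by
  ext ω
  simp only [sizeEvent, Set.mem_ofPred_eq, Set.mem_iUnion, treeEvent]
  constructor
  · exact exists_tree_of_encard_eq
  · rintro ⟨T, hT⟩
    rw [hT, Set.encard_coe_eq_coe_finsetCard]
    exact_mod_cast T.2

theorem pairwise_disjoint_treeEvent (ξ : List ℕ → Ω → ℕ) (n : ℕ) :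
    Pairwise (Function.onFun Disjoint fun T : TreeOfSize n => treeEvent ξ T.1) := by
  intro T T' hne
  refine Set.disjoint_left.2 fun ω h h' => hne (Subtype.ext (OrderedTree.ext ?_))
  exact_mod_cast (show treeOfDegrees (fun v => ξ v ω) = T.1.nodes from h).symm.trans h'

variable [MeasurableSpace Ω] {μ : Measure Ω} {ξ : List ℕ → Ω → ℕ} {p : ℕ → ℝ}

theorem measurableSet_treeEvent (hm : ∀ v, Measurable (ξ v)) (T : OrderedTree) :
    MeasurableSet (treeEvent ξ T) := by
  rw [treeEvent_eq]
  exact Finset.measurableSet_biInter _ fun v _ => hm v (measurableSet_singleton _)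

theorem measureReal_treeEvent (hi : iIndepFun ξ μ)
    (hp : ∀ v k, μ.real {ω | ξ v ω = k} = p k) (T : OrderedTree) :
    μ.real (treeEvent ξ T) = T.weight p := by
  rw [Measure.real, treeEvent_eq,
    hi.measure_inter_preimage_eq_mul T.nodes fun v _ => measurableSet_singleton _,
    ENNReal.toReal_prod, OrderedTree.weight]
  exact Finset.prod_congr rfl fun v _ => hp v _

theorem measureReal_sizeEvent [IsProbabilityMeasure μ] (hm : ∀ v, Measurable (ξ v))
    (hi : iIndepFun ξ μ) (hp : ∀ v k, μ.real {ω | ξ v ω = k} = p k) (n : ℕ) :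
    μ.real (sizeEvent ξ n) = totalWeight p n := by
  have := Fintype.ofFinite (TreeOfSize n)
  rw [sizeEvent_eq, measureReal_iUnion_fintype (pairwise_disjoint_treeEvent ξ n)
    fun T => measurableSet_treeEvent hm T.1, totalWeight, tsum_fintype]
  exact Finset.sum_congr rfl fun T _ => measureReal_treeEvent hi hp T.1

theorem conditionedGWMoment_eq [IsProbabilityMeasure μ] (hm : ∀ v, Measurable (ξ v))
    (hi : iIndepFun ξ μ) (hp : ∀ v k, μ.real {ω | ξ v ω = k} = p k) (m n : ℕ) :
    conditionedGWMoment μ ξ m n = simplyGeneratedMoment p m n := by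
  have := Fintype.ofFinite (TreeOfSize n)
  have hconst : ∀ T : TreeOfSize n, Set.EqOn
      (fun ω => (numRootSubtrees (treeOfDegrees fun v => ξ v ω) : ℝ) ^ m)
      (fun _ => (numRootSubtrees T.1.nodes : ℝ) ^ m) (treeEvent ξ T.1) := by
    intro T ω hω
    rw [treeEvent, Set.mem_ofPred_eq] at hω
    simp only [hω]
  have hmeas := fun T : TreeOfSize n => measurableSet_treeEvent hm T.1
  rw [conditionedGWMoment, ProbabilityTheory.cond, integral_smul_measure, simplyGeneratedMoment_eq,
    ENNReal.toReal_inv, ← Measure.real, measureReal_sizeEvent hm hi hp, sizeEvent_eq,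
    integral_iUnion_fintype hmeas (pairwise_disjoint_treeEvent ξ n) fun T =>
      (integrableOn_congr_fun (hconst T) (hmeas T)).2 (integrable_const _).integrableOn,
    coeffF, tsum_fintype, smul_eq_mul, div_eq_inv_mul]
  congr 1
  refine Finset.sum_congr rfl fun T _ => ?_
  rw [setIntegral_congr_fun (hmeas T) (hconst T), setIntegral_const,
    measureReal_treeEvent hi hp, smul_eq_mul]

theorem offspring_zero_pos [IsProbabilityMeasure μ] {X : Ω → ℕ}
    (h2 : MemLp (fun ω => (X ω : ℝ)) 2 μ) (h1 : ∫ ω, (X ω : ℝ) ∂μ = 1)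
    (hv : 0 < variance (fun ω => (X ω : ℝ)) μ) : 0 < μ.real {ω | X ω = 0} := by
  refine lt_of_le_of_ne measureReal_nonneg fun h0 => ?_
  have hint : Integrable (fun ω => (X ω : ℝ)) μ := h2.integrable (by norm_num)
  have hz : μ {ω | X ω = 0} = 0 := by
    rwa [eq_comm, measureReal_eq_zero_iff] at h0
  have hae : ∀ᵐ ω ∂μ, X ω ≠ 0 := by
    rw [ae_iff]
    simpa using hz
  have hnn : 0 ≤ᵐ[μ] fun ω => (X ω : ℝ) - 1 := by
    filter_upwards [hae] with ω hω
    have : (1 : ℝ) ≤ X ω := by exact_mod_cast Nat.one_le_iff_ne_zero.2 hω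
    simpa using this
  have hI : ∫ ω, ((X ω : ℝ) - 1) ∂μ = 0 := by
    rw [integral_sub hint (integrable_const 1), h1]
    simp
  have hone := (integral_eq_zero_iff_of_nonneg_ae hnn (hint.sub (integrable_const 1))).1 hI
  have hc : (fun ω => (X ω : ℝ)) =ᵐ[μ] fun _ => (1 : ℝ) := by
    filter_upwards [hone] with ω hω
    exact sub_eq_zero.1 hω
  rw [variance_congr hc, variance_eq_integral aemeasurable_const] at hv
  simp at hv

theorem radius_pos_of_le_one (h0 : ∀ k, 0 ≤ p k) (h1 : ∀ k, p k ≤ 1) : 0 < radius p := by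
  have hs : Summable fun n => p n * (1 / 2 : ℝ) ^ n :=
    (summable_geometric_of_lt_one (by norm_num) (by norm_num : (1 / 2 : ℝ) < 1)).of_nonneg_of_le
      (fun n => mul_nonneg (h0 n) (by positivity))
      fun n => mul_le_of_le_one_left (by positivity) (h1 n)
  exact (ENNReal.ofReal_pos.2 (by norm_num)).trans_le (le_radius_of_summable h0 (by norm_num) hs)

end

end RootSubtrees

end
open RootSubtrees in
theorem theorem3p2 :
    -- conditioned Galton-Watson trees, with offspring distribution the common law of the `ξ v`
    (∀ (Ω : Type*) [MeasurableSpace Ω] (μ : Measure Ω) [IsProbabilityMeasure μ]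
        (ξ : List ℕ → Ω → ℕ) (p : ℕ → ℝ),
        (∀ v, Measurable (ξ v)) →
        iIndepFun ξ μ →
        (∀ v k, μ.real {ω | ξ v ω = k} = p k) →
        MemLp (fun ω => (ξ [] ω : ℝ)) 2 μ →
        ∫ ω, (ξ [] ω : ℝ) ∂μ = 1 →
        0 < variance (fun ω => (ξ [] ω : ℝ)) μ →
        (∃ t : ℝ, 0 < t ∧ Integrable (fun ω => Real.exp (t * ξ [] ω)) μ) →
        Tendsto (deriv (generator p)) (upTo (radius p)) atTop →
        MomentAsymptotics (conditionedGWMoment μ ξ) {n | 0 < μ (sizeEvent ξ n)} (rho p)) ∧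
    -- simply generated trees
    (∀ w : ℕ → ℝ,
        (∀ i, 0 ≤ w i) →
        0 < w 0 →
        0 < radius w →
        (∃ ν : EReal, 1 < ν ∧
          Tendsto (fun z : ℝ => ((z * deriv (generator w) z / generator w z : ℝ) : EReal))
            (upTo (radius w)) (𝓝 ν)) →
        Tendsto (deriv (generator w)) (upTo (radius w)) atTop →
        MomentAsymptotics (simplyGeneratedMoment w) {n | 0 < totalWeight w n} (rho w)) := by
  refine ⟨?_, fun w h0 h1 h2 _ h3 => IsSteep.momentAsymptotics ⟨h0, h1, h2, h3⟩⟩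
  intro Ω _ μ _ ξ p hm hi hp h2 h1 hv _ ht
  have hp0 : ∀ k, 0 ≤ p k := fun k => hp [] k ▸ measureReal_nonneg
  have hp1 : ∀ k, p k ≤ 1 := fun k => hp [] k ▸ measureReal_le_one
  have hsteep : IsSteep p :=
    ⟨hp0, hp [] 0 ▸ offspring_zero_pos h2 h1 hv, radius_pos_of_le_one hp0 hp1, ht⟩
  have hN : {n | 0 < μ (sizeEvent ξ n)} = {n | 0 < totalWeight p n} := by
    ext n
    rw [Set.mem_ofPred_eq, Set.mem_ofPred_eq, ← measureReal_sizeEvent hm hi hp,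
      Measure.real, ENNReal.toReal_pos_iff]
    simp
  rw [hN]
  exact hsteep.momentAsymptotics.congr fun m n _ => conditionedGWMoment_eq hm hi hp m n
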